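/- **Theorem.** Let $n\ge 2$, let $\Omega\subset\mathbb R^n$ be bounded and open, and let $1<p<\infty$. Let $m$ be Lebesgue measure and $L^\infty_+(\Omega)=\{\sigma\in L^\infty(\Omega;\mathbb R):\operatorname{ess\,inf}\sigma>0\}$. Let $W_0^{1,p}(\Omega)$ be the closure of $C_c^\infty(\Omega)$ in $W^{1,p}(\Omega)$, let $X=W^{1,p}(\Omega)/W_0^{1,p}(\Omega)$, and let $X'$ be its dual. For $\sigma\in L^\infty_+(\Omega)$ and $f\in X$, let $u_\sigma^f$ be the minimizer of $E_\sigma(u)=\int_\Omega\sigma|\nabla u|^p\,dx$ among the $u\in W^{1,p}(\Omega)$ with boundary value $f$ (that is, with class $f$ in $X$). The Dirichlet–Neumann map $\Lambda_\sigma:X\to X'$ is $$(\Lambda_\sigma(f),g)=\int_\Omega\sigma|\nabla u_\sigma^f|^{p-2}\nabla u_\sigma^f\cdot\nabla v^g\,dx,$$ where $v^g\in W^{1,p}(\Omega)$ is any representative of $g\in X$. The minimizer exists and is unique, and $\Lambda_\sigma$ is well defined. The essential support $\operatorname{supp}h$ of a measurable $h:\Omega\to\mathbb R$ is the complement in $\Omega$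 of the union of all open $O\subseteq\Omega$ on which $h=0$ a.e. For $A\subseteq\mathbb R^n$, the closed essential convex hull $\operatorname{co}A$ is the intersection of all closed half-spaces $H_{\rho,t}=\{x: x\cdot\rho\le t\}$ ($\rho\in\mathbb R^n$, $t\in\mathbb R$) with $m(A\setminus H_{\rho,t})=0$. The measure theoretic interior $A^\circ$ is the set of the points of $A$ at which $A$ has density $1$. For operators $\Lambda,\Lambda'$ on $X$ write $\Lambda\le\Lambda'$ if $(\Lambda(f),f)\le(\Lambda'(f),f)$ for all $f\in X$. For measurable $B\subseteq\Omega$ put $(\Lambda_B(f),g)=\int_B|\nabla u_1^f|^{p-2}\nabla u_1^f\cdot\nabla u_1^g\,dx$, where $u_1^f,u_1^g$ are the minimizers for the conductivity $1$. *(Determination)* Let $\sigma_1,\sigma_2\in L^\infty_+(\Omega)$, each of which is either $\ge1$ a.e. or $\le1$ a.e. in $\Omega$. If $\Lambda_{\sigma_1}=\Lambda_{\sigma_2}$, then $$\operatorname{co}(\operatorname{supp}(\sigma_1-1))=\operatorname{co}(\operatorname{supp}(\sigma_2-1)),$$ and $\sigma_1\ge1$ a.e. if and only if $\sigma_2\ge1$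 a.e., and $\sigma_1\le1$ a.e. if and only if $\sigma_2\le1$ a.e. *(Recovery)* Let $\sigma\in L^\infty_+(\Omega)$ with either $\sigma\ge1$ a.e. or $\sigma\le1$ a.e. in $\Omega$. Then $$\operatorname{co}(\operatorname{supp}(\sigma-1))=\operatorname{co}\Big(\bigcup_{B\in\mathcal B}B^\circ\Big),$$ where $\mathcal B$ is the family of all measurable $B\subseteq\Omega$ for which there is $\alpha>0$ with $\Lambda_1+\alpha\Lambda_B\le\Lambda_\sigma$ or $\Lambda_\sigma\le\Lambda_1-\alpha\Lambda_B$. Moreover $\sigma\ge1$ a.e. if and only if $\Lambda_1\le\Lambda_\sigma$, and $\sigma\le1$ a.e. if and only if $\Lambda_\sigma\le\Lambda_1$. -/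

import Mathlib

open MeasureTheory Set Filter Topology
open scoped ENNReal ContDiff

noncomputable section

namespace PCalderon

/-- Euclidean space `ℝⁿ`. -/
abbrev E (n : ℕ) : Type := EuclideanSpace ℝ (Fin n)

/-! ### Essential support and essential convex hull -/

/-- The essential support of a function on `Ω`: the complement in `Ω` of the union of all open sets
`O ⊆ Ω` on which the function vanishes almost everywhere. -/
def essSupp {n : ℕ} (Ω : Set (E n)) (f : E n → ℝ) : Set (E n) :=
  Ω \ ⋃₀ {O | IsOpen O ∧ O ⊆ Ω ∧ ∀ᵐ x ∂(volume.restrict O), f x = 0}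

/-- The closed half-space `{x : x · ρ ≤ t}` (all of `ℝⁿ` or empty if `ρ = 0`). -/
def halfSpace {n : ℕ} (ρ : E n) (t : ℝ) : Set (E n) := {x | inner ℝ x ρ ≤ t}

/-- The closed essential convex hull: the intersection of all closed half-spaces that contain `A` up
to a null set. -/
def essConvexHull {n : ℕ} (A : Set (E n)) : Set (E n) :=
  {x | ∀ (ρ : E n) (t : ℝ), volume (A \ halfSpace ρ t) = 0 → x ∈ halfSpace ρ t}

/-- The measure theoretic interior: the points of `A` at which `A` has Lebesgue density `1`. -/
def measureInterior {n : ℕ} (A : Set (E n)) : Set (E n) :=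
  {x | x ∈ A ∧ Tendsto (fun ε : ℝ => volume (A ∩ Metric.ball x ε) / volume (Metric.ball x ε))
    (𝓝[>] 0) (𝓝 1)}

/-- The class `L^∞_+(Ω)`: essentially bounded measurable functions on `Ω` that are essentially
bounded below by a positive constant. -/
def LinftyPlus {n : ℕ} (Ω : Set (E n)) (σ : E n → ℝ) : Prop :=
  MemLp σ ∞ (volume.restrict Ω) ∧ ∃ c : ℝ, 0 < c ∧ ∀ᵐ x ∂(volume.restrict Ω), c ≤ σ x

/-! ### Sobolev spaces -/

instance factOneLe (p : ℝ) [hp : Fact (1 < p)] : Fact (1 ≤ ENNReal.ofReal p) :=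
  ⟨ENNReal.one_le_ofReal.2 hp.out.le⟩

/-- Test functions `C_c^∞(Ω)`. -/
def IsTestFunction {n : ℕ} (Ω : Set (E n)) (φ : E n → ℝ) : Prop :=
  ContDiff ℝ ∞ φ ∧ HasCompactSupport φ ∧ tsupport φ ⊆ Ω

/-- `L^p(Ω) × L^p(Ω; ℝⁿ)`, the ambient space of pairs (function, gradient). -/
abbrev PairSpace {n : ℕ} (Ω : Set (E n)) (p : ℝ) [Fact (1 < p)] : Type :=
  Lp ℝ (ENNReal.ofReal p) (volume.restrict Ω) × Lp (E n) (ENNReal.ofReal p) (volume.restrict Ω)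

/-- `G` is the weak (distributional) gradient of `u` on `Ω`. -/
def IsWeakGradient {n : ℕ} (Ω : Set (E n)) (u : E n → ℝ) (G : E n → E n) : Prop :=
  ∀ φ : E n → ℝ, IsTestFunction Ω φ → ∀ e : E n,
    ∫ x in Ω, fderiv ℝ φ x e * u x = -∫ x in Ω, φ x * inner ℝ (G x) e

theorem integrable_test_mul {n : ℕ} {Ω : Set (E n)} {p : ℝ} [Fact (1 < p)] {ψ : E n → ℝ}
    (hc : Continuous ψ) (hs : HasCompactSupport ψ)
    (u : Lp ℝ (ENNReal.ofReal p) (volume.restrict Ω)) :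
    Integrable (fun x => ψ x * u x) (volume.restrict Ω) :=
  ((Lp.memLp u).locallyIntegrable Fact.out).integrable_smul_left_of_hasCompactSupport hc hs

theorem integrable_test_mul_inner {n : ℕ} {Ω : Set (E n)} {p : ℝ} [Fact (1 < p)] {ψ : E n → ℝ}
    (hc : Continuous ψ) (hs : HasCompactSupport ψ)
    (G : Lp (E n) (ENNReal.ofReal p) (volume.restrict Ω)) (e : E n) :
    Integrable (fun x => ψ x * inner ℝ (G x) e) (volume.restrict Ω) := by
  have h := (((Lp.memLp G).locallyIntegrable
    Fact.out).integrable_smul_left_of_hasCompactSupport hc hs).inner_const (𝕜 := ℝ) e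
  simpa [real_inner_smul_left] using h

theorem continuous_fderiv_test {n : ℕ} {Ω : Set (E n)} {φ : E n → ℝ} (hφ : IsTestFunction Ω φ)
    (e : E n) : Continuous (fun x => fderiv ℝ φ x e) :=
  (hφ.1.continuous_fderiv (by simp)).clm_apply continuous_const

theorem hasCompactSupport_fderiv_test {n : ℕ} {Ω : Set (E n)} {φ : E n → ℝ}
    (hφ : IsTestFunction Ω φ) (e : E n) : HasCompactSupport (fun x => fderiv ℝ φ x e) :=
  hφ.2.1.fderiv_apply ℝ e

/-- The Sobolev space `W^{1,p}(Ω)`, as the space of pairs `(u, ∇u)` with `u ∈ L^p(Ω)` whose weak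
gradient `∇u` is in `L^p(Ω; ℝⁿ)`. It inherits the norm `max (‖u‖_p, ‖∇u‖_p)`, which is equivalent to
the usual one. -/
def sobolev {n : ℕ} (Ω : Set (E n)) (p : ℝ) [Fact (1 < p)] : Submodule ℝ (PairSpace Ω p) where
  carrier := {w | IsWeakGradient Ω w.1 w.2}
  zero_mem' := by
    intro φ hφ e
    have h1 : ∫ x in Ω, fderiv ℝ φ x e *
        (0 : Lp ℝ (ENNReal.ofReal p) (volume.restrict Ω)) x = 0 := by
      rw [← integral_zero (E n) ℝ (μ := volume.restrict Ω)]
      refine integral_congr_ae ?_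
      filter_upwards [Lp.coeFn_zero ℝ (ENNReal.ofReal p) (volume.restrict Ω)] with x hx
      rw [hx]; simp
    have h2 : ∫ x in Ω, φ x * inner ℝ
        ((0 : Lp (E n) (ENNReal.ofReal p) (volume.restrict Ω)) x) e = 0 := by
      rw [← integral_zero (E n) ℝ (μ := volume.restrict Ω)]
      refine integral_congr_ae ?_
      filter_upwards [Lp.coeFn_zero (E n) (ENNReal.ofReal p) (volume.restrict Ω)] with x hx
      rw [hx]; simp
    exact h1.trans (by rw [← neg_zero, ← h2]; rfl)
  add_mem' := by
    intro a b ha hb φ hφ e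
    have ha' := ha φ hφ e
    have hb' := hb φ hφ e
    have h1 : ∫ x in Ω, fderiv ℝ φ x e * (a + b).1 x =
        ∫ x in Ω, (fderiv ℝ φ x e * a.1 x + fderiv ℝ φ x e * b.1 x) := by
      refine integral_congr_ae ?_
      filter_upwards [Lp.coeFn_add a.1 b.1] with x hx
      rw [Prod.fst_add, hx, Pi.add_apply, mul_add]
    have h2 : ∫ x in Ω, φ x * inner ℝ ((a + b).2 x) e =
        ∫ x in Ω, (φ x * inner ℝ (a.2 x) e + φ x * inner ℝ (b.2 x) e) := by
      refine integral_congr_ae ?_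
      filter_upwards [Lp.coeFn_add a.2 b.2] with x hx
      rw [Prod.snd_add, hx, Pi.add_apply, inner_add_left, mul_add]
    rw [h1, h2, integral_add, integral_add, ha', hb', neg_add]
    · exact integrable_test_mul_inner hφ.1.continuous hφ.2.1 _ _
    · exact integrable_test_mul_inner hφ.1.continuous hφ.2.1 _ _
    · exact integrable_test_mul (continuous_fderiv_test hφ e) (hasCompactSupport_fderiv_test hφ e) _
    · exact integrable_test_mul (continuous_fderiv_test hφ e) (hasCompactSupport_fderiv_test hφ e) _
  smul_mem' := by
    intro c a ha φ hφ e
    have ha' := ha φ hφ e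
    have h1 : ∫ x in Ω, fderiv ℝ φ x e * (c • a).1 x =
        ∫ x in Ω, c * (fderiv ℝ φ x e * a.1 x) := by
      refine integral_congr_ae ?_
      filter_upwards [Lp.coeFn_smul c a.1] with x hx
      rw [Prod.smul_fst, hx, Pi.smul_apply, smul_eq_mul]; ring
    have h2 : ∫ x in Ω, φ x * inner ℝ ((c • a).2 x) e =
        ∫ x in Ω, c * (φ x * inner ℝ (a.2 x) e) := by
      refine integral_congr_ae ?_
      filter_upwards [Lp.coeFn_smul c a.2] with x hx
      rw [Prod.smul_snd, hx, Pi.smul_apply, real_inner_smul_left]; ring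
    rw [h1, h2, integral_const_mul, integral_const_mul, ha', mul_neg]

/-- The space `W^{1,p}(Ω)`. -/
abbrev W {n : ℕ} (Ω : Set (E n)) (p : ℝ) [Fact (1 < p)] : Type := sobolev Ω p

/-- The weak gradient of an element of `W^{1,p}(Ω)`. -/
def W.grad {n : ℕ} {Ω : Set (E n)} {p : ℝ} [Fact (1 < p)] (w : W Ω p) : E n → E n := w.1.2

/-- The (classes of) test functions, as a subspace of `W^{1,p}(Ω)`. -/
def testSubspace {n : ℕ} (Ω : Set (E n)) (p : ℝ) [Fact (1 < p)] : Submodule ℝ (W Ω p) where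
  carrier := {w | ∃ φ : E n → ℝ, IsTestFunction Ω φ ∧
    w.1.1 =ᵐ[volume.restrict Ω] φ ∧ w.1.2 =ᵐ[volume.restrict Ω] gradient φ}
  zero_mem' := by
    refine ⟨fun _ => 0, ⟨contDiff_const, HasCompactSupport.zero, ?_⟩, ?_, ?_⟩
    · simp [tsupport]
    · exact Lp.coeFn_zero ℝ (ENNReal.ofReal p) (volume.restrict Ω)
    · refine (Lp.coeFn_zero (E n) (ENNReal.ofReal p) (volume.restrict Ω)).trans ?_
      refine Eventually.of_forall fun x => ?_
      simp [gradient]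
  add_mem' := by
    rintro a b ⟨φ, hφ, h1, h2⟩ ⟨ψ, hψ, h3, h4⟩
    refine ⟨φ + ψ, ⟨hφ.1.add hψ.1, hφ.2.1.add hψ.2.1, ?_⟩, ?_, ?_⟩
    · exact (tsupport_add φ ψ).trans (union_subset hφ.2.2 hψ.2.2)
    · exact (Lp.coeFn_add a.1.1 b.1.1).trans (h1.add h3)
    · refine (Lp.coeFn_add a.1.2 b.1.2).trans ((h2.add h4).trans ?_)
      refine Eventually.of_forall fun x => ?_
      have e1 : DifferentiableAt ℝ φ x := (hφ.1.differentiable (by simp)) x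
      have e2 : DifferentiableAt ℝ ψ x := (hψ.1.differentiable (by simp)) x
      simp [gradient, fderiv_add e1 e2]
  smul_mem' := by
    rintro c a ⟨φ, hφ, h1, h2⟩
    refine ⟨c • φ, ⟨hφ.1.const_smul c, hφ.2.1.smul_left (f := fun _ => c), ?_⟩, ?_, ?_⟩
    · exact (tsupport_smul_subset_right (fun _ => c) φ).trans hφ.2.2
    · exact (Lp.coeFn_smul c a.1.1).trans (h1.const_smul c)
    · refine (Lp.coeFn_smul c a.1.2).trans ((h2.const_smul c).trans ?_)
      refine Eventually.of_forall fun x => ?_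
      have e1 : DifferentiableAt ℝ φ x := (hφ.1.differentiable (by simp)) x
      simp [gradient, fderiv_const_smul e1 c]

/-- `W_0^{1,p}(Ω)`, the closure of the test functions in `W^{1,p}(Ω)`. -/
def sobolevZero {n : ℕ} (Ω : Set (E n)) (p : ℝ) [Fact (1 < p)] : Submodule ℝ (W Ω p) :=
  (testSubspace Ω p).topologicalClosure

/-- The space of abstract boundary values `X = W^{1,p}(Ω) / W_0^{1,p}(Ω)`; its dual `X'` is
`StrongDual ℝ (X Ω p)`. -/
abbrev X {n : ℕ} (Ω : Set (E n)) (p : ℝ) [Fact (1 < p)] : Type := W Ω p ⧸ sobolevZero Ω p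

/-- The boundary value in `X` of an element of `W^{1,p}(Ω)`. -/
def trace {n : ℕ} {Ω : Set (E n)} {p : ℝ} [Fact (1 < p)] (w : W Ω p) : X Ω p :=
  (sobolevZero Ω p).mkQ w

/-! ### The forward problem and the Dirichlet–Neumann map -/

/-- The `p`-Dirichlet energy `∫_Ω σ |∇u|^p`. -/
def energy {n : ℕ} {Ω : Set (E n)} {p : ℝ} [Fact (1 < p)] (σ : E n → ℝ) (u : W Ω p) : ℝ :=
  ∫ x in Ω, σ x * ‖u.grad x‖ ^ p

/-- `u` minimizes the energy among all functions with boundary value `f`. -/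
def IsMinimizer {n : ℕ} {Ω : Set (E n)} {p : ℝ} [Fact (1 < p)] (σ : E n → ℝ) (f : X Ω p)
    (u : W Ω p) : Prop :=
  trace u = f ∧ ∀ v : W Ω p, trace v = f → energy σ u ≤ energy σ v

/-- The weak solution `u_σ^f`: the minimizer of the energy with boundary value `f`. -/
def solution {n : ℕ} {Ω : Set (E n)} {p : ℝ} [Fact (1 < p)] (σ : E n → ℝ) (f : X Ω p) : W Ω p :=
  Classical.epsilon (IsMinimizer σ f)

/-- `∫_A σ |∇u|^{p-2} ∇u · ∇v`. -/
def fluxForm {n : ℕ} {Ω : Set (E n)} {p : ℝ} [Fact (1 < p)] (A : Set (E n)) (σ : E n → ℝ)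
    (u v : W Ω p) : ℝ :=
  ∫ x in A, σ x * ‖u.grad x‖ ^ (p - 2) * inner ℝ (u.grad x) (v.grad x)

/-- The Dirichlet–Neumann map `Λ_σ : X → X'`: `Λ_σ f` is the functional that sends the boundary value
of `v ∈ W^{1,p}(Ω)` to `∫_Ω σ |∇u|^{p-2} ∇u · ∇v`, where `u = u_σ^f`. -/
def dnMap {n : ℕ} (Ω : Set (E n)) (p : ℝ) [Fact (1 < p)] (σ : E n → ℝ) (f : X Ω p) :
    StrongDual ℝ (X Ω p) :=
  Classical.epsilon fun ℓ : StrongDual ℝ (X Ω p) =>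
    ∀ v : W Ω p, ℓ (trace v) = fluxForm Ω σ (solution σ f) v

/-! ### Monotonicity tests -/

/-- The preorder on operators `X → (X → ℝ)` given by the associated forms. -/
def OpLE {Y : Type} (A B : Y → Y → ℝ) : Prop := ∀ f, A f f ≤ B f f

/-- The test operator `Λ_B`: `(Λ_B f, g) = ∫_B |∇u_0^f|^{p-2} ∇u_0^f · ∇u_0^g`, where `u_0^f`, `u_0^g`
are the `p`-harmonic functions with boundary values `f`, `g`. -/
def testOp {n : ℕ} (Ω : Set (E n)) (p : ℝ) [Fact (1 < p)] (B : Set (E n)) (f g : X Ω p) : ℝ :=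
  fluxForm B (fun _ => 1) (solution (fun _ => 1) f) (solution (fun _ => 1) g)

/-- The family of the Lebesgue measurable sets `B ⊆ Ω` that the monotonicity test marks for an
operator `Λ`: for some `α > 0`, `Λ_1 + α Λ_B ≤ Λ` or `Λ ≤ Λ_1 - α Λ_B`. -/
def markedSets {n : ℕ} (Ω : Set (E n)) (p : ℝ) [Fact (1 < p)]
    (Λ : X Ω p → StrongDual ℝ (X Ω p)) : Set (Set (E n)) :=
  {B | B ⊆ Ω ∧ NullMeasurableSet B volume ∧ ∃ α : ℝ, 0 < α ∧
    (OpLE (fun f g => dnMap Ω p (fun _ => 1) f g + α * testOp Ω p B f g) (fun f g => Λ f g) ∨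
      OpLE (fun f g => Λ f g) (fun f g => dnMap Ω p (fun _ => 1) f g - α * testOp Ω p B f g))}

end PCalderon

end

noncomputable section

namespace PCalderon

/-! ### Pointwise inequalities -/

section Pointwise

variable {F : Type*} [NormedAddCommGroup F] [InnerProductSpace ℝ F] {p : ℝ}

/-! Write `v` for the minimizer with conductivity `1` and boundary value `f`. The proof rests on the
sandwich `(p-1) ∫ (1 - σ^(-1/(p-1))) |∇v|^p ≤ (Λ_σ f, f) - (Λ_1 f, f) ≤ ∫ (σ - 1) |∇v|^p`. The upper
bound (`dnMap_sub_le`) uses `v` as a competitor for the energy of `σ`; the lower bound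
(`le_dnMap_sub`) is Young's inequality with weight `σ` applied to the flux of `v` paired with the
minimizer for `σ`. Both weights have the sign of `σ - 1` and vanish exactly where `σ = 1`. Hence,
when `σ - 1` has a sign, the difference of the forms, up to that sign, dominates a multiple of `∫_B
|∇v|^p` for every measurable `B ⊆ Ω` on which `|σ - 1|` is bounded below, and is dominated by a
multiple of `∫_(Ω ∩ A) |∇v|^p` whenever `σ = 1` off `A`. This is `IsControlled`.

Such energies are separated by Wolff's solutions (`exists_exponential_solution`), for which `|∇w|^p`
is comparable to `|ξ|^p exp(p x·ξ)` with constants independent of `ξ`. With `ξ = τρ` and `τ → ∞` the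
energy concentrates where `x·ρ` is largest, so a test operator dominated by the energy in `{x·ρ ≤
t}` comes from a set lying there up to a null set (`volume_diff_halfSpace_eq_zero`).

Therefore every marked set has its density points in each closed half-space off which `σ = 1` a.e.;
conversely the level sets `{|σ - 1| ≥ δ}` are marked and exhaust `{σ ≠ 1}` up to a null set. This is
recovery of the hull (`IsControlled.essConvexHull_eq`). If the difference also has the opposite
sign, all level sets are null and `σ = 1` a.e., which recovers the sign. Determination follows
because the recovered data depend on `Λ_σ` only. -/

theorem norm_rpow_sub_two_mul_inner_self (hp : 1 < p) (a : F) :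
    ‖a‖ ^ (p - 2) * inner ℝ a a = ‖a‖ ^ p := by
  rw [real_inner_self_eq_norm_sq]
  rcases eq_or_ne a 0 with rfl | h
  · simp [Real.zero_rpow (by linarith : p ≠ 0)]
  · rw [← Real.rpow_natCast, ← Real.rpow_add (norm_pos_iff.2 h)]
    norm_num

theorem norm_rpow_sub_two_smul (hp : 1 < p) (a : F) : ‖‖a‖ ^ (p - 2) • a‖ = ‖a‖ ^ (p - 1) := by
  rw [norm_smul, Real.norm_of_nonneg (by positivity)]
  rcases eq_or_ne a 0 with rfl | h
  · simp [Real.zero_rpow (by linarith : p - 1 ≠ 0)]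
  · rw [← Real.rpow_add_one (norm_ne_zero_iff.2 h)]
    ring_nf

theorem abs_norm_rpow_sub_two_mul_inner_le (hp : 1 < p) (a b : F) :
    |‖a‖ ^ (p - 2) * inner ℝ a b| ≤ ‖a‖ ^ (p - 1) * ‖b‖ := by
  rw [← norm_rpow_sub_two_smul hp, ← real_inner_smul_left]
  exact abs_real_inner_le_norm _ _

/-- Young's inequality with a weight. -/
theorem young_weighted (hp : 1 < p) {s x y : ℝ} (hs : 0 < s) (hx : 0 ≤ x) (hy : 0 ≤ y) :
    p * (y ^ (p - 1) * x) ≤ s * x ^ p + (p - 1) * (s ^ (-(1 / (p - 1))) * y ^ p) := by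
  have hp0 : 0 < p := by linarith
  have hp1 : 0 < p - 1 := by linarith
  have hpq : p.HolderConjugate (p / (p - 1)) := Real.HolderConjugate.conjExponent hp
  -- The factors `s^(1/p)` and `s^(-1/p)` cancel in the product and distribute the weight between
  -- the two powers.
  have h := Real.young_inequality_of_nonneg (a := s ^ (1 / p) * x)
    (b := s ^ (-(1 / p)) * y ^ (p - 1)) (by positivity) (by positivity) hpq
  have e1 : s ^ (1 / p) * x * (s ^ (-(1 / p)) * y ^ (p - 1)) = y ^ (p - 1) * x := by
    rw [Real.rpow_neg hs.le]
    have : s ^ (1 / p) ≠ 0 := (Real.rpow_pos_of_pos hs _).ne'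
    field_simp
  have e2 : (s ^ (1 / p) * x) ^ p = s * x ^ p := by
    rw [Real.mul_rpow (by positivity) hx, ← Real.rpow_mul hs.le, one_div_mul_cancel hp0.ne',
      Real.rpow_one]
  have e3 : (s ^ (-(1 / p)) * y ^ (p - 1)) ^ (p / (p - 1)) = s ^ (-(1 / (p - 1))) * y ^ p := by
    rw [Real.mul_rpow (by positivity) (by positivity), ← Real.rpow_mul hs.le, ← Real.rpow_mul hy]
    congr 2 <;> field_simp
  rw [e1, e2, e3] at h
  have := mul_le_mul_of_nonneg_left h hp0.le
  refine this.trans (le_of_eq ?_)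
  field_simp

/-- This is Young's inequality with weight `1` after Cauchy–Schwarz; it is the subgradient
inequality behind `LinftyPlus.energy_convex`. -/
theorem norm_rpow_convex (hp : 1 < p) (a b : F) :
    ‖b‖ ^ p + p * (‖b‖ ^ (p - 2) * inner ℝ b (a - b)) ≤ ‖a‖ ^ p := by
  have h1 := young_weighted hp one_pos (norm_nonneg a) (norm_nonneg b)
  have h2 := (le_abs_self _).trans (abs_norm_rpow_sub_two_mul_inner_le hp b a)
  have h3 := mul_le_mul_of_nonneg_left h2 (by linarith : 0 ≤ p)
  rw [inner_sub_right, mul_sub, norm_rpow_sub_two_mul_inner_self hp]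
  simp only [Real.one_rpow, one_mul] at h1
  linarith

theorem norm_midpoint_rpow_lt (hp : 1 < p) {a b : F} (h : a ≠ b) :
    ‖(1 / 2 : ℝ) • (a + b)‖ ^ p < (‖a‖ ^ p + ‖b‖ ^ p) / 2 := by
  have hp0 : 0 < p := by linarith
  by_cases hab : ‖a‖ = ‖b‖
  · have := (norm_midpoint_lt_iff hab).2 h
    have := Real.rpow_lt_rpow (norm_nonneg _) this hp0
    rw [← hab]
    linarith
  · have h1 : ‖(1 / 2 : ℝ) • (a + b)‖ ≤ (1 / 2 : ℝ) • ‖a‖ + (1 / 2 : ℝ) • ‖b‖ := by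
      rw [norm_smul, smul_eq_mul, smul_eq_mul, Real.norm_of_nonneg (by norm_num)]
      linarith [norm_add_le a b]
    have h2 := (strictConvexOn_rpow hp).2 (norm_nonneg a) (norm_nonneg b) hab
      (by norm_num : (0 : ℝ) < 1 / 2) (by norm_num : (0 : ℝ) < 1 / 2) (by norm_num)
    have h3 := Real.rpow_le_rpow (norm_nonneg _) h1 hp0.le
    simp only [smul_eq_mul] at h2 h3
    linarith

theorem norm_midpoint_rpow_le (hp : 1 < p) (a b : F) :
    ‖(1 / 2 : ℝ) • (a + b)‖ ^ p ≤ (‖a‖ ^ p + ‖b‖ ^ p) / 2 := by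
  rcases eq_or_ne a b with rfl | h
  · rw [← two_smul ℝ, smul_smul]
    norm_num
  · exact (norm_midpoint_rpow_lt hp h).le

/-- Uniform convexity of `a ↦ ‖a‖ ^ p` in quantitative form. -/
theorem exists_norm_sub_rpow_le [FiniteDimensional ℝ F] (hp : 1 < p) {ε : ℝ} (hε : 0 < ε) :
    ∃ C : ℝ, 0 ≤ C ∧ ∀ a b : F, ‖a - b‖ ^ p ≤ ε * (‖a‖ ^ p + ‖b‖ ^ p) +
      C * ((‖a‖ ^ p + ‖b‖ ^ p) / 2 - ‖(1 / 2 : ℝ) • (a + b)‖ ^ p) := by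
  have hp0 : 0 < p := by linarith
  have hcn : Continuous fun x : F => ‖x‖ ^ p :=
    continuous_norm.rpow_const fun _ => Or.inr hp0.le
  -- By homogeneity it suffices to treat pairs with `‖a‖^p + ‖b‖^p = 1`. Those with `‖a - b‖^p ≥ ε`
  -- form a compact set, on which the midpoint gap is continuous and positive, hence at least some
  -- `δ > 0`. Pairs with smaller difference are absorbed by the `ε` term.
  let K : Set (F × F) := {z | ‖z.1‖ ^ p + ‖z.2‖ ^ p = 1 ∧ ε ≤ ‖z.1 - z.2‖ ^ p}
  have hg : Continuous fun z : F × F =>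
      (‖z.1‖ ^ p + ‖z.2‖ ^ p) / 2 - ‖(1 / 2 : ℝ) • (z.1 + z.2)‖ ^ p :=
    (((hcn.comp continuous_fst).add (hcn.comp continuous_snd)).div_const 2).sub
      (hcn.comp ((continuous_fst.add continuous_snd).const_smul (1 / 2 : ℝ)))
  have hle1 : ∀ x : F, ‖x‖ ^ p ≤ 1 → ‖x‖ ≤ 1 := fun x hx => by
    by_contra h
    exact absurd hx (not_le.2 (Real.one_lt_rpow (not_le.1 h) hp0))
  have hKc : IsCompact K := by
    have : ProperSpace (F × F) := FiniteDimensional.proper ℝ _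
    refine Metric.isCompact_of_isClosed_isBounded ?_ ?_
    · exact (isClosed_eq ((hcn.comp continuous_fst).add (hcn.comp continuous_snd))
        continuous_const).inter (isClosed_le continuous_const
          (hcn.comp (continuous_fst.sub continuous_snd)))
    · refine (Metric.isBounded_closedBall (x := (0 : F × F)) (r := 1)).subset fun z hz => ?_
      rw [mem_closedBall_zero_iff, Prod.norm_def, max_le_iff]
      have h1 : 0 ≤ ‖z.1‖ ^ p := by positivity
      have h2 : 0 ≤ ‖z.2‖ ^ p := by positivity
      have h3 := hz.1
      exact ⟨hle1 _ (by linarith), hle1 _ (by linarith)⟩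
  obtain ⟨δ, hδ, hmin⟩ : ∃ δ : ℝ, 0 < δ ∧ ∀ z ∈ K,
      δ ≤ (‖z.1‖ ^ p + ‖z.2‖ ^ p) / 2 - ‖(1 / 2 : ℝ) • (z.1 + z.2)‖ ^ p := by
    refine hKc.exists_forall_le' (a := 0) hg.continuousOn fun z hz => ?_
    refine sub_pos.2 (norm_midpoint_rpow_lt hp fun h => ?_)
    have := hz.2
    rw [h, sub_self, norm_zero, Real.zero_rpow hp0.ne'] at this
    linarith
  refine ⟨2 ^ p * δ⁻¹, by positivity, fun a b => ?_⟩
  have hgap := sub_nonneg.2 (norm_midpoint_rpow_le hp a b)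
  set S := ‖a‖ ^ p + ‖b‖ ^ p with hS
  have ha0 : 0 ≤ ‖a‖ ^ p := by positivity
  have hb0 : 0 ≤ ‖b‖ ^ p := by positivity
  by_cases hcase : ‖a - b‖ ^ p ≤ ε * S
  · have : 0 ≤ 2 ^ p * δ⁻¹ * (S / 2 - ‖(1 / 2 : ℝ) • (a + b)‖ ^ p) := by positivity
    linarith
  push Not at hcase
  have hSpos : 0 < S := by
    rcases (add_nonneg ha0 hb0).lt_or_eq with h | h
    · exact h
    · have h1 : ‖a‖ ^ p = 0 := by linarith
      have h2 : ‖b‖ ^ p = 0 := by linarith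
      rw [Real.rpow_eq_zero (norm_nonneg _) hp0.ne', norm_eq_zero] at h1 h2
      rw [h1, h2, sub_zero, norm_zero, Real.zero_rpow hp0.ne'] at hcase
      have : 0 ≤ ε * S := mul_nonneg hε.le (add_nonneg ha0 hb0)
      linarith
  have hscale : ∀ x : F, ‖(S ^ (-(1 / p))) • x‖ ^ p = S⁻¹ * ‖x‖ ^ p := fun x => by
    rw [norm_smul, Real.norm_of_nonneg (by positivity), Real.mul_rpow (by positivity)
      (norm_nonneg _), ← Real.rpow_mul hSpos.le, neg_mul, one_div_mul_cancel hp0.ne',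
      Real.rpow_neg_one]
  have hK : ((S ^ (-(1 / p))) • a, (S ^ (-(1 / p))) • b) ∈ K := by
    refine ⟨?_, ?_⟩
    · simp only [hscale]
      rw [← mul_add]
      exact inv_mul_cancel₀ hSpos.ne'
    · simp only [← smul_sub, hscale]
      rw [inv_mul_eq_div, le_div_iff₀ hSpos]
      exact hcase.le
  have h1 := hmin _ hK
  simp only [← smul_add, smul_comm (1 / 2 : ℝ) (S ^ (-(1 / p))), hscale] at h1
  have h2 : δ * S ≤ S / 2 - ‖(1 / 2 : ℝ) • (a + b)‖ ^ p := by
    have := mul_le_mul_of_nonneg_right h1 hSpos.le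
    refine this.trans (le_of_eq ?_)
    rw [← mul_add, ← hS, inv_mul_cancel₀ hSpos.ne', sub_mul, mul_right_comm,
      inv_mul_cancel₀ hSpos.ne']
    ring
  -- Midpoint convexity for `a` and `-b`; together with the gap bound `δ * S` this produces the
  -- constant `2^p / δ`.
  have h3 : ‖a - b‖ ^ p ≤ 2 ^ p * S := by
    have hm := norm_midpoint_rpow_le hp a (-b)
    rw [norm_smul, Real.mul_rpow (by positivity) (norm_nonneg _), norm_neg, ← sub_eq_add_neg,
      Real.norm_of_nonneg (by norm_num), Real.div_rpow (by norm_num) (by norm_num),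
      Real.one_rpow] at hm
    have h2p : (0 : ℝ) < 2 ^ p := by positivity
    rw [div_mul_eq_mul_div, one_mul, div_le_iff₀ h2p] at hm
    nlinarith
  have h4 : 2 ^ p * S ≤ 2 ^ p * δ⁻¹ * (S / 2 - ‖(1 / 2 : ℝ) • (a + b)‖ ^ p) := by
    have h5 : S ≤ δ⁻¹ * (S / 2 - ‖(1 / 2 : ℝ) • (a + b)‖ ^ p) := by
      rw [inv_mul_eq_div, le_div_iff₀ hδ]; linarith
    rw [mul_assoc]
    exact mul_le_mul_of_nonneg_left h5 (by positivity)
  have h6 : 0 ≤ ε * S := by positivity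
  linarith

end Pointwise

/-! ### Integrability and the flux functional -/

section Lp

variable {α F : Type*} [MeasurableSpace α] {μ : Measure α} [NormedAddCommGroup F] {p : ℝ}
  [hp : Fact (1 < p)]

theorem exponent_pos : 0 < p := zero_lt_one.trans hp.out

theorem ofReal_exponent_ne_zero : ENNReal.ofReal p ≠ 0 :=
  (ENNReal.ofReal_pos.2 exponent_pos).ne'

theorem toReal_ofReal_exponent : (ENNReal.ofReal p).toReal = p :=
  ENNReal.toReal_ofReal exponent_pos.le

theorem integrable_norm_rpow_of_memLp {f : α → F} (hf : MemLp f (ENNReal.ofReal p) μ) :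
    Integrable (fun x => ‖f x‖ ^ p) μ := by
  simpa only [toReal_ofReal_exponent] using
    hf.integrable_norm_rpow ofReal_exponent_ne_zero ENNReal.ofReal_ne_top

theorem Lp_norm_rpow_eq_integral (f : Lp F (ENNReal.ofReal p) μ) :
    ‖f‖ ^ p = ∫ x, ‖f x‖ ^ p ∂μ := by
  have h0 : 0 ≤ ∫ x, ‖f x‖ ^ p ∂μ := integral_nonneg fun x => by positivity
  rw [Lp.norm_def, (Lp.memLp f).eLpNorm_eq_integral_rpow_norm ofReal_exponent_ne_zero
    ENNReal.ofReal_ne_top, toReal_ofReal_exponent (p := p), ENNReal.toReal_ofReal (by positivity),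
    ← Real.rpow_mul h0, inv_mul_cancel₀ (exponent_pos (p := p)).ne', Real.rpow_one]

theorem memLp_norm_rpow_sub_one [NormedSpace ℝ F] {f : α → F}
    (hf : MemLp f (ENNReal.ofReal p) μ) :
    MemLp (fun x => ‖f x‖ ^ (p - 2) • f x) (ENNReal.ofReal (p / (p - 1))) μ := by
  have hp1 : 0 < p - 1 := sub_pos.2 hp.out
  have h := hf.norm_rpow_div (ENNReal.ofReal (p - 1))
  rw [← ENNReal.ofReal_div_of_pos hp1, ENNReal.toReal_ofReal hp1.le] at h
  refine h.mono ?_ (Eventually.of_forall fun x => le_of_eq ?_)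
  · exact (hf.1.norm.aemeasurable.pow_const _).aestronglyMeasurable.smul hf.1
  · rw [norm_smul, Real.norm_of_nonneg (by positivity), Real.norm_of_nonneg (by positivity)]
    rcases eq_or_ne (f x) 0 with h | h
    · simp [h, Real.zero_rpow hp1.ne']
    · rw [← Real.rpow_add_one (norm_ne_zero_iff.2 h)]
      ring_nf

/-- Integration against an `L^q` function is a continuous functional on `L^p`. -/
theorem exists_continuousLinearMap_integral_inner [InnerProductSpace ℝ F] {H : α → F}
    (hH : MemLp H (ENNReal.ofReal (p / (p - 1))) μ) :
    ∃ L : Lp F (ENNReal.ofReal p) μ →L[ℝ] ℝ, ∀ G, L G = ∫ x, inner ℝ (H x) (G x) ∂μ := by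
  have : ENNReal.HolderConjugate (ENNReal.ofReal (p / (p - 1))) (ENNReal.ofReal p) :=
    (Real.HolderConjugate.conjExponent hp.out).symm.ennrealOfReal
  have : Fact (1 ≤ ENNReal.ofReal (p / (p - 1))) := ⟨ENNReal.one_le_ofReal.2
    ((one_le_div (sub_pos.2 hp.out)).2 (by linarith))⟩
  refine ⟨(innerSL ℝ (E := F)).lpPairing μ _ _ (hH.toLp H), fun G => ?_⟩
  rw [ContinuousLinearMap.lpPairing_eq_integral]
  refine integral_congr_ae ?_
  filter_upwards [hH.coeFn_toLp] with x hx
  rw [hx, innerSL_apply_apply]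

end Lp

section Forms

variable {n : ℕ} {Ω : Set (E n)} {p : ℝ} [hp : Fact (1 < p)] {σ : E n → ℝ}

theorem LinftyPlus.exists_bounds (hσ : LinftyPlus Ω σ) :
    ∃ c M : ℝ, 0 < c ∧ 0 < M ∧ ∀ᵐ x ∂(volume.restrict Ω), c ≤ σ x ∧ σ x ≤ M ∧ ‖σ x‖ ≤ M := by
  obtain ⟨h, c, hc, hcσ⟩ := hσ
  obtain ⟨M, hM⟩ : ∃ M : ℝ, ∀ᵐ x ∂(volume.restrict Ω), ‖σ x‖ ≤ M := by
    refine ⟨(eLpNorm σ ∞ (volume.restrict Ω)).toReal, ?_⟩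
    have hfin := h.2.ne
    rw [eLpNorm_exponent_top] at hfin ⊢
    filter_upwards [enorm_ae_le_eLpNormEssSup σ (volume.restrict Ω)] with x hx
    rw [← toReal_enorm]
    exact ENNReal.toReal_mono hfin hx
  refine ⟨c, max M 1, hc, by positivity, ?_⟩
  filter_upwards [hcσ, hM] with x h1 h2
  exact ⟨h1, ((Real.le_norm_self _).trans h2).trans (le_max_left _ _), h2.trans (le_max_left _ _)⟩

theorem linftyPlus_one : LinftyPlus Ω (fun _ => 1) :=
  ⟨memLp_top_const _, 1, one_pos, Eventually.of_forall fun _ => le_rfl⟩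

theorem W.memLp_grad (u : W Ω p) : MemLp u.grad (ENNReal.ofReal p) (volume.restrict Ω) :=
  Lp.memLp u.1.2

theorem W.integrable_grad (u : W Ω p) :
    Integrable (fun x => ‖u.grad x‖ ^ p) (volume.restrict Ω) :=
  integrable_norm_rpow_of_memLp u.memLp_grad

theorem W.grad_add (u v : W Ω p) :
    (u + v).grad =ᵐ[volume.restrict Ω] fun x => u.grad x + v.grad x :=
  Lp.coeFn_add u.1.2 v.1.2

theorem W.grad_sub (u v : W Ω p) :
    (u - v).grad =ᵐ[volume.restrict Ω] fun x => u.grad x - v.grad x :=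
  Lp.coeFn_sub u.1.2 v.1.2

theorem W.grad_smul (c : ℝ) (u : W Ω p) :
    (c • u).grad =ᵐ[volume.restrict Ω] fun x => c • u.grad x :=
  Lp.coeFn_smul c u.1.2

theorem LinftyPlus.integrable_mul (hσ : LinftyPlus Ω σ) {g : E n → ℝ}
    (hg : Integrable g (volume.restrict Ω)) :
    Integrable (fun x => σ x * g x) (volume.restrict Ω) := by
  obtain ⟨c, M, -, -, h⟩ := hσ.exists_bounds
  exact hg.bdd_mul hσ.1.1 (h.mono fun x hx => hx.2.2)

theorem LinftyPlus.integrable_energy (hσ : LinftyPlus Ω σ) (u : W Ω p) :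
    Integrable (fun x => σ x * ‖u.grad x‖ ^ p) (volume.restrict Ω) :=
  hσ.integrable_mul u.integrable_grad

theorem LinftyPlus.memLp_flux (hσ : LinftyPlus Ω σ) (u : W Ω p) :
    MemLp (fun x => (σ x * ‖u.grad x‖ ^ (p - 2)) • u.grad x) (ENNReal.ofReal (p / (p - 1)))
      (volume.restrict Ω) := by
  obtain ⟨c, M, -, -, h⟩ := hσ.exists_bounds
  have h1 := memLp_norm_rpow_sub_one u.memLp_grad
  refine MemLp.of_le_mul (c := M) h1 ?_ ?_
  · simp only [mul_smul]
    exact hσ.1.1.smul h1.1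
  · filter_upwards [h] with x hx
    rw [mul_smul, norm_smul]
    gcongr
    exact hx.2.2

theorem LinftyPlus.integrable_flux (hσ : LinftyPlus Ω σ) (u v : W Ω p) :
    Integrable (fun x => σ x * ‖u.grad x‖ ^ (p - 2) * inner ℝ (u.grad x) (v.grad x))
      (volume.restrict Ω) := by
  have : ENNReal.HolderTriple (ENNReal.ofReal (p / (p - 1))) (ENNReal.ofReal p) 1 :=
    (Real.HolderConjugate.conjExponent hp.out).symm.ennrealOfReal
  have h := (innerSL ℝ (E := E n)).memLp_of_bilin 1 (hσ.memLp_flux u) v.memLp_grad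
  exact (memLp_one_iff_integrable.1 h).congr
    (Eventually.of_forall fun x => (innerSL_apply_apply ℝ _ _).trans (real_inner_smul_left _ _ _))

/-- The flux form as a continuous functional of its second argument. -/
theorem LinftyPlus.exists_fluxForm_eq (hσ : LinftyPlus Ω σ) (u : W Ω p) :
    ∃ L : W Ω p →L[ℝ] ℝ, ∀ v, L v = fluxForm Ω σ u v := by
  obtain ⟨L, hL⟩ := exists_continuousLinearMap_integral_inner (hσ.memLp_flux u)
  refine ⟨L.comp ((ContinuousLinearMap.snd ℝ _ _).comp (sobolev Ω p).subtypeL), fun v => ?_⟩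
  refine (hL v.1.2).trans ?_
  unfold fluxForm
  simp only [real_inner_smul_left]
  rfl

theorem fluxForm_self (A : Set (E n)) (u : W Ω p) :
    fluxForm A σ u u = ∫ x in A, σ x * ‖u.grad x‖ ^ p := by
  unfold fluxForm
  simp only [mul_assoc, norm_rpow_sub_two_mul_inner_self hp.out]

theorem testOp_self (B : Set (E n)) (f : X Ω p) :
    testOp Ω p B f f = ∫ x in B, ‖(solution (fun _ => 1) f).grad x‖ ^ p := by
  rw [testOp, fluxForm_self]
  simp

/-- Test functions and their derivatives lie in the dual exponent space, so each identity defining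
the weak gradient is an equation between continuous functionals of the pair. Closedness gives
completeness of `W^{1,p}(Ω)`. -/
theorem isClosed_sobolev : IsClosed (sobolev Ω p : Set (PairSpace Ω p)) := by
  have : (sobolev Ω p : Set (PairSpace Ω p)) = ⋂ φ : {φ : E n → ℝ // IsTestFunction Ω φ},
      ⋂ e : E n, {w | ∫ x in Ω, fderiv ℝ φ.1 x e * w.1 x =
        -∫ x in Ω, φ.1 x * inner ℝ (w.2 x) e} := by
    ext w
    simp only [mem_iInter, Subtype.forall]
    rfl
  rw [this]
  refine isClosed_iInter fun φ => isClosed_iInter fun e => ?_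
  obtain ⟨φ, hφ⟩ := φ
  obtain ⟨L₁, h₁⟩ := exists_continuousLinearMap_integral_inner (p := p) (F := ℝ)
    ((continuous_fderiv_test hφ e).memLp_of_hasCompactSupport
      (hasCompactSupport_fderiv_test hφ e) (μ := volume.restrict Ω)
      (p := ENNReal.ofReal (p / (p - 1))))
  obtain ⟨L₂, h₂⟩ := exists_continuousLinearMap_integral_inner (p := p) (F := E n)
    ((hφ.1.continuous.smul (continuous_const (y := e))).memLp_of_hasCompactSupport
      (hφ.2.1.smul_right (f' := fun _ => e)) (μ := volume.restrict Ω)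
      (p := ENNReal.ofReal (p / (p - 1))))
  have hc : IsClosed {w : PairSpace Ω p | L₁ w.1 = -L₂ w.2} :=
    isClosed_eq (L₁.continuous.comp continuous_fst) (L₂.continuous.comp continuous_snd).neg
  have e₁ : ∀ w : PairSpace Ω p, L₁ w.1 = ∫ x in Ω, fderiv ℝ φ x e * w.1 x := fun w => by
    rw [h₁]
    simp only [RCLike.inner_apply, conj_trivial, mul_comm]
  have e₂ : ∀ w : PairSpace Ω p, L₂ w.2 = ∫ x in Ω, φ x * inner ℝ (w.2 x) e := fun w => by
    rw [h₂]
    simp only [Pi.smul_apply', real_inner_smul_left, real_inner_comm e]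
  simpa only [e₁, e₂] using hc

instance : CompleteSpace (W Ω p) := isClosed_sobolev.completeSpace_coe

end Forms

/-! ### The Poincaré inequality -/

section Poincare

variable {n : ℕ} {Ω : Set (E n)} {p : ℝ} [hp : Fact (1 < p)]

theorem norm_gradient {φ : E n → ℝ} (x : E n) : ‖gradient φ x‖ = ‖fderiv ℝ φ x‖ :=
  LinearIsometryEquiv.norm_map _ _

theorem IsTestFunction.eq_zero {φ : E n → ℝ} (hφ : IsTestFunction Ω φ) {x : E n} (hx : x ∉ Ω) :
    φ x = 0 :=
  image_eq_zero_of_notMem_tsupport fun h => hx (hφ.2.2 h)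

/-- The Poincaré inequality for test functions. -/
theorem IsTestFunction.integral_norm_rpow_le {φ : E n → ℝ} (hφ : IsTestFunction Ω φ) {e : E n}
    (he : ‖e‖ = 1) {r s : ℝ} (hs : 0 < s) (hr0 : 0 ≤ r) (hr : ∀ x ∈ Ω, ‖x‖ ≤ r) :
    ∫ x, ‖φ x‖ ^ p ≤ s * r ^ p * (∫ x, ‖gradient φ x‖ ^ p) +
      (p - 1) * s ^ (-(1 / (p - 1))) * ∫ x, ‖φ x‖ ^ p := by
  have hp1 : 0 < p - 1 := sub_pos.2 hp.out
  have hp0 : 0 < p := exponent_pos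
  have hφ1 : ContDiff ℝ 1 φ := hφ.1.of_le (by simp)
  have hφd : Differentiable ℝ φ := hφ1.differentiable (by simp)
  let f : E n → ℝ := fun x => ‖φ x‖ ^ p
  have hf1 : ContDiff ℝ 1 f := hφ1.norm_rpow hp.out
  have hfs : HasCompactSupport f := by
    refine hφ.2.1.comp_left (g := fun t : ℝ => ‖t‖ ^ p) ?_
    simp [Real.zero_rpow hp0.ne']
  have hf'c : Continuous fun x => fderiv ℝ f x e :=
    (hf1.continuous_fderiv (by simp)).clm_apply continuous_const
  have hf's : HasCompactSupport fun x => fderiv ℝ f x e := hfs.fderiv_apply ℝ e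
  -- The derivative of `g` along `e` is `1`, so integrating `|φ|^p · 1` by parts moves the
  -- derivative onto `|φ|^p` at the cost of a factor `g`, which is at most `r` in absolute value on
  -- `Ω`.
  let g : E n → ℝ := fun x => inner ℝ e x
  have hgd : ∀ x, HasFDerivAt g (innerSL ℝ e) x := fun x => (innerSL ℝ e).hasFDerivAt
  have hgc : Continuous g := continuous_const.inner continuous_id
  have hge : ∀ x, fderiv ℝ g x e = 1 := fun x => by
    rw [(hgd x).fderiv, innerSL_apply_apply, real_inner_self_eq_norm_sq, he, one_pow]
  have hfi : Integrable f := hf1.continuous.integrable_of_hasCompactSupport hfs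
  have ibp := integral_mul_fderiv_eq_neg_fderiv_mul_of_integrable (μ := volume) (f := f) (g := g)
    (v := e) ((hf'c.mul hgc).integrable_of_hasCompactSupport hf's.mul_right)
    (by simpa only [hge, mul_one] using hfi)
    ((hf1.continuous.mul hgc).integrable_of_hasCompactSupport hfs.mul_right)
    (fun x _ => hf1.differentiable (by simp) x) (fun x _ => (hgd x).differentiableAt)
  simp only [hge, mul_one] at ibp
  have hgrc : Continuous fun x => ‖gradient φ x‖ ^ p := by
    simp only [norm_gradient]
    exact (hφ1.continuous_fderiv (by simp)).norm.rpow_const fun _ => Or.inr hp0.le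
  have hgrs : HasCompactSupport fun x => ‖gradient φ x‖ ^ p := by
    simp only [norm_gradient]
    refine (hφ.2.1.fderiv ℝ).comp_left (g := fun t : E n →L[ℝ] ℝ => ‖t‖ ^ p) ?_
    simp [Real.zero_rpow hp0.ne']
  have hgri := hgrc.integrable_of_hasCompactSupport (μ := volume) hgrs
  change ∫ x, f x ≤ s * r ^ p * _ + (p - 1) * s ^ (-(1 / (p - 1))) * ∫ x, f x
  rw [← integral_const_mul, ← integral_const_mul,
    ← integral_add (hgri.const_mul _) (hfi.const_mul _), ibp, ← integral_neg]
  refine integral_mono ((hf'c.mul hgc).integrable_of_hasCompactSupport hf's.mul_right).neg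
    ((hgri.const_mul _).add (hfi.const_mul _)) fun x => ?_
  refine (neg_le_abs _).trans ?_
  rw [abs_mul]
  have h1 : |fderiv ℝ f x e| ≤ p * ‖φ x‖ ^ (p - 1) * ‖gradient φ x‖ := by
    refine ((fderiv ℝ f x).le_opNorm e).trans ?_
    rw [he, mul_one, norm_gradient]
    exact norm_fderiv_norm_rpow_le hφd hp.out
  have h2 : |fderiv ℝ f x e| * |g x| ≤ p * ‖φ x‖ ^ (p - 1) * ‖gradient φ x‖ * r := by
    by_cases hx : x ∈ Ω
    · refine mul_le_mul h1 ?_ (abs_nonneg _) (by positivity)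
      refine (abs_real_inner_le_norm _ _).trans ?_
      rw [he, one_mul]
      exact hr x hx
    · have h0 : φ x = 0 := hφ.eq_zero hx
      have h3 : |fderiv ℝ f x e| ≤ 0 := by simpa [h0, Real.zero_rpow hp1.ne'] using h1
      rw [le_antisymm h3 (abs_nonneg _), zero_mul]
      positivity
  have h3 := young_weighted hp.out hs (x := r * ‖gradient φ x‖) (by positivity)
    (norm_nonneg (φ x))
  rw [Real.mul_rpow hr0 (norm_nonneg _)] at h3
  calc _ ≤ _ := h2
    _ = p * (‖φ x‖ ^ (p - 1) * (r * ‖gradient φ x‖)) := by ring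
    _ ≤ _ := h3
    _ = _ := by simp only [f]; ring

theorem setIntegral_eq_integral_of_support {g : E n → ℝ} (h : ∀ x ∉ Ω, g x = 0) :
    ∫ x in Ω, g x = ∫ x, g x :=
  setIntegral_eq_integral_of_forall_compl_eq_zero h

/-- The Poincaré inequality on `W_0^{1,p}`. -/
theorem exists_norm_fst_le_of_mem_sobolevZero (hn : 0 < n) (hΩb : Bornology.IsBounded Ω) :
    ∃ C : ℝ, 0 ≤ C ∧ ∀ w ∈ sobolevZero Ω p, ‖w.1.1‖ ≤ C * ‖w.1.2‖ := by
  have hp1 : 0 < p - 1 := sub_pos.2 hp.out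
  have hp0 : 0 < p := exponent_pos
  obtain ⟨r, hr0, hr⟩ := hΩb.exists_pos_norm_le
  let e : E n := EuclideanSpace.single ⟨0, hn⟩ 1
  have he : ‖e‖ = 1 := by simp [e]
  -- This weight makes the coefficient of `∫ |φ|^p` on the right equal to `1/2`, so that the term
  -- can be absorbed on the left.
  let s : ℝ := (2 * (p - 1)) ^ (p - 1)
  have hs : 0 < s := by positivity
  have hsp : (p - 1) * s ^ (-(1 / (p - 1))) = 1 / 2 := by
    rw [← Real.rpow_mul (by positivity), mul_neg, mul_one_div_cancel hp1.ne', Real.rpow_neg_one]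
    field_simp
  refine ⟨(2 * s) ^ (1 / p) * r, by positivity, fun w hw => ?_⟩
  refine closure_minimal (t := {w : W Ω p | ‖w.1.1‖ ≤ (2 * s) ^ (1 / p) * r * ‖w.1.2‖}) ?_ ?_ hw
  · rintro w ⟨φ, hφ, h1, h2⟩
    have hpc := hφ.integral_norm_rpow_le (p := p) he hs hr0.le hr
    rw [hsp] at hpc
    have e1 : ‖w.1.1‖ ^ p = ∫ x, ‖φ x‖ ^ p := by
      rw [Lp_norm_rpow_eq_integral, ← setIntegral_eq_integral_of_support (Ω := Ω)]
      · exact integral_congr_ae (h1.mono fun x hx => by simp only [hx])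
      · intro x hx
        rw [hφ.eq_zero hx, norm_zero, Real.zero_rpow hp0.ne']
    have e2 : ‖w.1.2‖ ^ p = ∫ x, ‖gradient φ x‖ ^ p := by
      rw [Lp_norm_rpow_eq_integral, ← setIntegral_eq_integral_of_support (Ω := Ω)]
      · exact integral_congr_ae (h2.mono fun x hx => by simp only [hx])
      · intro x hx
        rw [norm_gradient, image_eq_zero_of_notMem_tsupport (f := fderiv ℝ φ)
          fun h => hx (hφ.2.2 (tsupport_fderiv_subset ℝ h)), norm_zero, Real.zero_rpow hp0.ne']
    rw [← e1, ← e2] at hpc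
    refine (Real.rpow_le_rpow_iff (norm_nonneg _) (by positivity) hp0).1 ?_
    rw [Real.mul_rpow (by positivity) (by positivity), Real.mul_rpow (by positivity) hr0.le,
      ← Real.rpow_mul (by positivity), one_div_mul_cancel hp0.ne', Real.rpow_one]
    linarith
  · exact isClosed_le (continuous_fst.comp continuous_subtype_val).norm
      (continuous_const.mul (continuous_snd.comp continuous_subtype_val).norm)

end Poincare

/-! ### Well-posedness of the forward problem -/

section Forward

variable {n : ℕ} {Ω : Set (E n)} {p : ℝ} [hp : Fact (1 < p)] {σ : E n → ℝ}

theorem trace_eq_trace_iff {u v : W Ω p} : trace u = trace v ↔ u - v ∈ sobolevZero Ω p :=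
  Submodule.Quotient.eq _

theorem exists_trace_eq (f : X Ω p) : ∃ u : W Ω p, trace u = f :=
  (sobolevZero Ω p).mkQ_surjective f

theorem trace_add_smul {a b : ℝ} (hab : a + b = 1) {u v : W Ω p} {f : X Ω p} (hu : trace u = f)
    (hv : trace v = f) : trace (a • u + b • v) = f := by
  unfold trace at *
  rw [map_add, map_smul, map_smul, hu, hv, ← add_smul, hab, one_smul]

theorem LinftyPlus.energy_nonneg (hσ : LinftyPlus Ω σ) (u : W Ω p) : 0 ≤ energy σ u := by
  obtain ⟨c, M, hc, -, h⟩ := hσ.exists_bounds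
  refine integral_nonneg_of_ae (h.mono fun x hx => ?_)
  have := hc.le.trans hx.1
  simp only [Pi.zero_apply]
  positivity

theorem LinftyPlus.exists_coercive (hσ : LinftyPlus Ω σ) :
    ∃ c : ℝ, 0 < c ∧ ∀ u : W Ω p, c * ‖u.1.2‖ ^ p ≤ energy σ u := by
  obtain ⟨c, M, hc, -, h⟩ := hσ.exists_bounds
  refine ⟨c, hc, fun u => ?_⟩
  rw [Lp_norm_rpow_eq_integral, ← integral_const_mul]
  refine integral_mono_ae (u.integrable_grad.const_mul c) (hσ.integrable_energy u)
    (h.mono fun x hx => ?_)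
  exact mul_le_mul_of_nonneg_right hx.1 (by positivity)

theorem LinftyPlus.energy_convex (hσ : LinftyPlus Ω σ) (u v : W Ω p) :
    energy σ u + p * fluxForm Ω σ u (v - u) ≤ energy σ v := by
  obtain ⟨c, M, hc, -, h⟩ := hσ.exists_bounds
  unfold energy fluxForm
  rw [← integral_const_mul, ← integral_add (hσ.integrable_energy u)
    ((hσ.integrable_flux u _).const_mul p)]
  refine integral_mono_ae ((hσ.integrable_energy u).add ((hσ.integrable_flux u _).const_mul p))
    (hσ.integrable_energy v) ?_
  filter_upwards [h, W.grad_sub v u] with x hx hg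
  have := mul_le_mul_of_nonneg_left (norm_rpow_convex hp.out (v.grad x) (u.grad x))
    (hc.le.trans hx.1)
  simp only [hg]
  linarith

theorem LinftyPlus.exists_energy_sub_le (hσ : LinftyPlus Ω σ) {ε : ℝ} (hε : 0 < ε) :
    ∃ C : ℝ, 0 ≤ C ∧ ∀ u v : W Ω p, energy σ (u - v) ≤ ε * (energy σ u + energy σ v) +
      C * ((energy σ u + energy σ v) / 2 - energy σ ((1 / 2 : ℝ) • u + (1 / 2 : ℝ) • v)) := by
  obtain ⟨C, hC, hle⟩ := exists_norm_sub_rpow_le (F := E n) hp.out hε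
  obtain ⟨c, M, hc, -, h⟩ := hσ.exists_bounds
  refine ⟨C, hC, fun u v => ?_⟩
  unfold energy
  have iu := hσ.integrable_energy u
  have iv := hσ.integrable_energy v
  have im := hσ.integrable_energy ((1 / 2 : ℝ) • u + (1 / 2 : ℝ) • v)
  have is : Integrable (fun x => σ x * ‖u.grad x‖ ^ p + σ x * ‖v.grad x‖ ^ p)
    (volume.restrict Ω) := iu.add iv
  have ig : Integrable (fun x => (σ x * ‖u.grad x‖ ^ p + σ x * ‖v.grad x‖ ^ p) / 2 -
      σ x * ‖((1 / 2 : ℝ) • u + (1 / 2 : ℝ) • v).grad x‖ ^ p) (volume.restrict Ω) :=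
    (is.div_const 2).sub im
  rw [← integral_add iu iv, ← integral_const_mul, ← integral_div,
    ← integral_sub (is.div_const 2) im, ← integral_const_mul,
    ← integral_add (is.const_mul ε) (ig.const_mul C)]
  refine integral_mono_ae (hσ.integrable_energy _) ((is.const_mul ε).add (ig.const_mul C)) ?_
  filter_upwards [h, W.grad_sub u v, W.grad_add ((1 / 2 : ℝ) • u) ((1 / 2 : ℝ) • v),
    W.grad_smul (1 / 2 : ℝ) u, W.grad_smul (1 / 2 : ℝ) v] with x hx h1 h2 h3 h4
  have := mul_le_mul_of_nonneg_left (hle (u.grad x) (v.grad x)) (hc.le.trans hx.1)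
  simp only [h1, h2, h3, h4]
  rw [← smul_add]
  linarith

theorem exists_norm_le_of_mem_sobolevZero (hn : 0 < n) (hΩb : Bornology.IsBounded Ω) :
    ∃ C : ℝ, 0 ≤ C ∧ ∀ w ∈ sobolevZero Ω p, ‖w‖ ≤ C * ‖w.1.2‖ := by
  obtain ⟨C, hC, h⟩ := exists_norm_fst_le_of_mem_sobolevZero (p := p) hn hΩb
  refine ⟨max C 1, by positivity, fun w hw => ?_⟩
  change max ‖w.1.1‖ ‖w.1.2‖ ≤ _
  refine max_le ((h w hw).trans ?_) ?_
  · exact mul_le_mul_of_nonneg_right (le_max_left _ _) (norm_nonneg _)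
  · exact le_mul_of_one_le_left (norm_nonneg _) (le_max_right _ _)

/-- On `W_0^{1,p}` the norm is controlled by the energy. -/
theorem LinftyPlus.exists_norm_rpow_le (hσ : LinftyPlus Ω σ) (hn : 0 < n)
    (hΩb : Bornology.IsBounded Ω) :
    ∃ C : ℝ, 0 ≤ C ∧ ∀ w ∈ sobolevZero Ω p, ‖w‖ ≤ C * energy σ w ^ (1 / p) := by
  have hp0 : 0 < p := exponent_pos
  obtain ⟨C, hC, h⟩ := exists_norm_le_of_mem_sobolevZero (p := p) hn hΩb
  obtain ⟨c, hc, hcoer⟩ := hσ.exists_coercive (p := p)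
  refine ⟨C * c⁻¹ ^ (1 / p), by positivity, fun w hw => (h w hw).trans ?_⟩
  rw [mul_assoc]
  refine mul_le_mul_of_nonneg_left ?_ hC
  rw [← Real.mul_rpow (by positivity) (hσ.energy_nonneg w)]
  have h1 : ‖w.1.2‖ ^ p ≤ c⁻¹ * energy σ w := by
    rw [inv_mul_eq_div, le_div_iff₀ hc, mul_comm]
    exact hcoer w
  have h2 := Real.rpow_le_rpow (by positivity) h1 (by positivity : 0 ≤ 1 / p)
  rwa [← Real.rpow_mul (norm_nonneg _), mul_one_div_cancel hp0.ne', Real.rpow_one] at h2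

/-- Uniform convexity replaces weak compactness: midpoints of a minimizing sequence are admissible,
so the midpoint gaps tend to `0`, the energies of the differences tend to `0`, and Poincaré makes
the sequence Cauchy in norm. -/
theorem LinftyPlus.exists_isMinimizer (hσ : LinftyPlus Ω σ) (hn : 0 < n)
    (hΩb : Bornology.IsBounded Ω) (f : X Ω p) : ∃ u : W Ω p, IsMinimizer σ f u := by
  have hp0 : 0 < p := exponent_pos
  let S : Set ℝ := energy σ '' {v : W Ω p | trace v = f}
  obtain ⟨u₀, hu₀⟩ := exists_trace_eq f
  have hSne : S.Nonempty := ⟨_, u₀, hu₀, rfl⟩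
  have hSb : BddBelow S := ⟨0, by rintro _ ⟨v, -, rfl⟩; exact hσ.energy_nonneg v⟩
  obtain ⟨a, -, hat, haS⟩ := exists_seq_tendsto_sInf hSne hSb
  choose u hu hua using haS
  set m := sInf S with hm
  have hmle : ∀ v : W Ω p, trace v = f → m ≤ energy σ v := fun v hv => csInf_le hSb ⟨v, hv, rfl⟩
  have hEt : Tendsto (fun k => energy σ (u k)) atTop (𝓝 m) := by simpa only [hua] using hat
  have hm0 : 0 ≤ m := le_csInf hSne (by rintro _ ⟨v, -, rfl⟩; exact hσ.energy_nonneg v)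
  have hE1 : Tendsto (fun k : ℕ × ℕ => energy σ (u k.1)) atTop (𝓝 m) := by
    rw [← prod_atTop_atTop_eq]; exact hEt.comp tendsto_fst
  have hE2 : Tendsto (fun k : ℕ × ℕ => energy σ (u k.2)) atTop (𝓝 m) := by
    rw [← prod_atTop_atTop_eq]; exact hEt.comp tendsto_snd
  have hdiff : Tendsto (fun k : ℕ × ℕ => energy σ (u k.1 - u k.2)) atTop (𝓝 0) := by
    rw [Metric.tendsto_nhds]
    intro η hη
    -- With this `ε` the first term tends to `2mη / (2m + 1) < η`, while the gap term tends to `0`.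
    obtain ⟨C, hC, hle⟩ := hσ.exists_energy_sub_le (p := p) (ε := η / (2 * m + 1)) (by positivity)
    have hlim := ((hE1.add hE2).const_mul (η / (2 * m + 1))).add
      ((((hE1.add hE2).div_const 2).sub_const m).const_mul C)
    have hlt : η / (2 * m + 1) * (m + m) + C * ((m + m) / 2 - m) < η := by
      rw [add_self_div_two, sub_self, mul_zero, add_zero, div_mul_eq_mul_div,
        div_lt_iff₀ (by positivity)]
      nlinarith
    filter_upwards [hlim.eventually_lt_const hlt] with k hk
    rw [Real.dist_eq, sub_zero, abs_of_nonneg (hσ.energy_nonneg _)]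
    refine lt_of_le_of_lt ((hle _ _).trans ?_) hk
    have := hmle _ (trace_add_smul (by norm_num : (1 / 2 : ℝ) + 1 / 2 = 1) (hu k.1) (hu k.2))
    gcongr
  obtain ⟨K, hK, hnorm⟩ := hσ.exists_norm_rpow_le (p := p) hn hΩb
  have hmem : ∀ v w : W Ω p, trace v = f → trace w = f → v - w ∈ sobolevZero Ω p :=
    fun v w hv hw => trace_eq_trace_iff.1 (hv.trans hw.symm)
  have hcau : CauchySeq u := by
    rw [cauchySeq_iff_tendsto_dist_atTop_0]
    have hz : Tendsto (fun k : ℕ × ℕ => K * energy σ (u k.1 - u k.2) ^ (1 / p)) atTop (𝓝 0) := by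
      have := (hdiff.rpow_const (p := 1 / p) (Or.inr (by positivity))).const_mul K
      rwa [Real.zero_rpow (by positivity), mul_zero] at this
    refine squeeze_zero (fun _ => dist_nonneg) (fun k => ?_) hz
    rw [dist_eq_norm]
    exact hnorm _ (hmem _ _ (hu _) (hu _))
  obtain ⟨v, hv⟩ := cauchySeq_tendsto_of_complete hcau
  have hvt : trace v = f := by
    rw [← hu₀, trace_eq_trace_iff]
    exact (testSubspace Ω p).isClosed_topologicalClosure.mem_of_tendsto (hv.sub_const u₀)
      (Eventually.of_forall fun k => hmem _ _ (hu k) hu₀)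
  refine ⟨v, hvt, fun w hw => le_trans ?_ (hmle w hw)⟩
  -- Lower semicontinuity at the limit `v`: the affine minorant of the energy at `v` is continuous,
  -- so its values at `u k` converge to the energy of `v`.
  obtain ⟨L, hL⟩ := hσ.exists_fluxForm_eq v
  have hL0 : Tendsto (fun k => energy σ v + p * L (u k - v)) atTop (𝓝 (energy σ v)) := by
    have := ((L.continuous.tendsto _).comp (hv.sub_const v)).const_mul p |>.const_add (energy σ v)
    rwa [sub_self, map_zero, mul_zero, add_zero] at this
  refine le_of_tendsto_of_tendsto' hL0 hEt fun k => ?_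
  rw [hL]
  exact hσ.energy_convex v (u k)

theorem LinftyPlus.isMinimizer_unique (hσ : LinftyPlus Ω σ) (hn : 0 < n)
    (hΩb : Bornology.IsBounded Ω) {f : X Ω p} {u v : W Ω p} (hu : IsMinimizer σ f u)
    (hv : IsMinimizer σ f v) : u = v := by
  have hp0 : 0 < p := exponent_pos
  have huv : energy σ u = energy σ v := le_antisymm (hu.2 v hv.1) (hv.2 u hu.1)
  have hE0 := hσ.energy_nonneg v
  have hE : energy σ (u - v) ≤ 0 := by
    refine le_of_forall_pos_le_add fun η hη => ?_
    obtain ⟨C, hC, hle⟩ := hσ.exists_energy_sub_le (p := p)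
      (ε := η / (2 * energy σ v + 1)) (by positivity)
    -- The midpoint of two minimizers is admissible, so its energy is not smaller and the gap term
    -- is nonpositive.
    refine (hle u v).trans ?_
    have h1 := hv.2 _ (trace_add_smul (by norm_num : (1 / 2 : ℝ) + 1 / 2 = 1) hu.1 hv.1)
    rw [huv]
    have h2 : C * ((energy σ v + energy σ v) / 2 -
        energy σ ((1 / 2 : ℝ) • u + (1 / 2 : ℝ) • v)) ≤ 0 :=
      mul_nonpos_of_nonneg_of_nonpos hC (by linarith)
    have h3 : η / (2 * energy σ v + 1) * (energy σ v + energy σ v) ≤ η := by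
      rw [div_mul_eq_mul_div, div_le_iff₀ (by positivity)]
      nlinarith
    linarith
  obtain ⟨K, hK, hnorm⟩ := hσ.exists_norm_rpow_le (p := p) hn hΩb
  have := hnorm _ (trace_eq_trace_iff.1 (hu.1.trans hv.1.symm))
  rw [le_antisymm hE (hσ.energy_nonneg _), Real.zero_rpow (by positivity), mul_zero] at this
  exact sub_eq_zero.1 (norm_le_zero_iff.1 this)

theorem LinftyPlus.existsUnique_isMinimizer (hσ : LinftyPlus Ω σ) (hn : 0 < n)
    (hΩb : Bornology.IsBounded Ω) (f : X Ω p) : ∃! u : W Ω p, IsMinimizer σ f u := by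
  obtain ⟨u, hu⟩ := hσ.exists_isMinimizer hn hΩb f
  exact ⟨u, hu, fun v hv => hσ.isMinimizer_unique hn hΩb hv hu⟩

theorem LinftyPlus.isMinimizer_solution (hσ : LinftyPlus Ω σ) (hn : 0 < n)
    (hΩb : Bornology.IsBounded Ω) (f : X Ω p) : IsMinimizer σ f (solution σ f) :=
  Classical.epsilon_spec (hσ.exists_isMinimizer hn hΩb f)

theorem LinftyPlus.solution_eq (hσ : LinftyPlus Ω σ) (hn : 0 < n)
    (hΩb : Bornology.IsBounded Ω) {f : X Ω p} {u : W Ω p} (hu : IsMinimizer σ f u) :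
    solution σ f = u :=
  hσ.isMinimizer_unique hn hΩb (hσ.isMinimizer_solution hn hΩb f) hu

/-- The Euler–Lagrange equation of a minimizer. -/
theorem IsMinimizer.fluxForm_eq_zero (hσ : LinftyPlus Ω σ) {f : X Ω p} {u : W Ω p}
    (hu : IsMinimizer σ f u) {w : W Ω p} (hw : w ∈ sobolevZero Ω p) : fluxForm Ω σ u w = 0 := by
  have hp0 : 0 < p := exponent_pos
  obtain ⟨c, M, hc, hM, hb⟩ := hσ.exists_bounds
  have hgrad : ∀ t : ℝ, (u + t • w).grad =ᵐ[volume.restrict Ω] fun x => u.grad x + t • w.grad x :=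
    fun t => by
      filter_upwards [W.grad_add u (t • w), W.grad_smul t w] with x h1 h2
      rw [h1, h2]
  let F : ℝ → E n → ℝ := fun t x => σ x * ‖u.grad x + t • w.grad x‖ ^ p
  let F' : ℝ → E n → ℝ := fun t x => σ x * (p * (‖u.grad x + t • w.grad x‖ ^ (p - 2) *
    inner ℝ (u.grad x + t • w.grad x) (w.grad x)))
  have hF : ∀ t, (fun x => σ x * ‖(u + t • w).grad x‖ ^ p) =ᵐ[volume.restrict Ω] F t := fun t =>
    (hgrad t).mono fun x hx => by simp only [hx, F]
  have hFi : ∀ t, Integrable (F t) (volume.restrict Ω) := fun t =>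
    (hσ.integrable_energy (u + t • w)).congr (hF t)
  have hF0 : F' 0 = fun x => p * (σ x * ‖u.grad x‖ ^ (p - 2) * inner ℝ (u.grad x) (w.grad x)) := by
    funext x
    simp only [F', zero_smul, add_zero]
    ring
  -- The energy is differentiated under the integral along `u + t w`; for `|t| < 1` the derivative
  -- is dominated by `M p (|∇u| + |∇w|)^p`.
  have key := hasDerivAt_integral_of_dominated_loc_of_deriv_le (𝕜 := ℝ)
    (μ := volume.restrict Ω) (F := F) (F' := F') (x₀ := 0)
    (s := Metric.ball 0 1) (bound := fun x => M * (p * ‖‖u.grad x‖ + ‖w.grad x‖‖ ^ p))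
    (Metric.ball_mem_nhds _ one_pos) (Eventually.of_forall fun t => (hFi t).1) (hFi 0)
    (by rw [hF0]; exact ((hσ.integrable_flux u w).const_mul p).1) ?_ ?_ ?_
  · have hmin : IsLocalMin (fun t => ∫ x in Ω, F t x) 0 := by
      refine Eventually.of_forall fun t => ?_
      have h0 : ∀ t, ∫ x in Ω, F t x = energy σ (u + t • w) := fun t =>
        (integral_congr_ae (hF t)).symm
      simp only [h0, zero_smul, add_zero]
      refine hu.2 _ ?_
      rw [← hu.1, trace_eq_trace_iff, add_sub_cancel_left]
      exact Submodule.smul_mem _ _ hw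
    have := hmin.hasDerivAt_eq_zero key.2
    rw [hF0, integral_const_mul] at this
    exact (mul_eq_zero.1 this).resolve_left hp0.ne'
  · filter_upwards [hb] with x hx t ht
    rw [mem_ball_zero_iff, Real.norm_eq_abs] at ht
    have h1 := abs_norm_rpow_sub_two_mul_inner_le hp.out (u.grad x + t • w.grad x) (w.grad x)
    have h2 : ‖u.grad x + t • w.grad x‖ ≤ ‖u.grad x‖ + ‖w.grad x‖ := by
      refine (norm_add_le _ _).trans (add_le_add le_rfl ?_)
      rw [norm_smul, Real.norm_eq_abs]
      exact mul_le_of_le_one_left (norm_nonneg _) ht.le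
    have h3 : ‖u.grad x + t • w.grad x‖ ^ (p - 1) * ‖w.grad x‖ ≤
        (‖u.grad x‖ + ‖w.grad x‖) ^ p := by
      have h4 : (‖u.grad x‖ + ‖w.grad x‖) ^ p =
          (‖u.grad x‖ + ‖w.grad x‖) ^ (p - 1) * (‖u.grad x‖ + ‖w.grad x‖) := by
        rw [← Real.rpow_add_one' (by positivity) (by linarith), sub_add_cancel]
      rw [h4]
      refine mul_le_mul (Real.rpow_le_rpow (norm_nonneg _) h2 (by linarith [hp.out]))
        (le_add_of_nonneg_left (norm_nonneg _)) (norm_nonneg _) (by positivity)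
    have h5 : ‖(‖u.grad x‖ + ‖w.grad x‖ : ℝ)‖ = ‖u.grad x‖ + ‖w.grad x‖ :=
      Real.norm_of_nonneg (by positivity)
    rw [h5]
    simp only [F']
    rw [norm_mul, norm_mul p, Real.norm_of_nonneg hp0.le]
    refine mul_le_mul hx.2.2 (mul_le_mul_of_nonneg_left ?_ hp0.le) (by positivity) hM.le
    exact h1.trans h3
  · exact ((integrable_norm_rpow_of_memLp
      (u.memLp_grad.norm.add w.memLp_grad.norm)).const_mul p).const_mul M
  · refine Eventually.of_forall fun x t _ => ?_
    have h1 : HasDerivAt (fun t : ℝ => u.grad x + t • w.grad x) (w.grad x) t := by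
      simpa using ((hasDerivAt_id t).smul_const (w.grad x)).const_add (u.grad x)
    have h2 := ((hasFDerivAt_norm_rpow (u.grad x + t • w.grad x) hp.out).comp_hasDerivAt t
      h1).const_mul (σ x)
    refine h2.congr_deriv ?_
    simp only [F', _root_.smul_apply, innerSL_apply_apply, smul_eq_mul, mul_assoc]

/-- By convexity the Euler–Lagrange equation is also sufficient, and continuity of the flux
functional extends it from test functions to their closure. -/
theorem LinftyPlus.isMinimizer_of_fluxForm_eq_zero (hσ : LinftyPlus Ω σ) {u : W Ω p}
    (hu : ∀ w ∈ testSubspace Ω p, fluxForm Ω σ u w = 0) : IsMinimizer σ (trace u) u := by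
  refine ⟨rfl, fun v hv => ?_⟩
  obtain ⟨L, hL⟩ := hσ.exists_fluxForm_eq u
  have h0 : ∀ w ∈ sobolevZero Ω p, L w = 0 := fun w hw =>
    closure_minimal (t := {w : W Ω p | L w = 0}) (fun w hw => (hL w).trans (hu w hw))
      (isClosed_eq L.continuous continuous_const) hw
  have h1 := hσ.energy_convex u v
  rwa [← hL, h0 _ (trace_eq_trace_iff.1 hv), mul_zero, add_zero] at h1

/-- The Euler–Lagrange equation says that the flux functional vanishes on `W_0^{1,p}`, so it
descends to the quotient and the choice in `dnMap` has a witness. -/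
theorem dnMap_trace (hσ : LinftyPlus Ω σ) (hn : 0 < n) (hΩb : Bornology.IsBounded Ω) (f : X Ω p)
    (v : W Ω p) : dnMap Ω p σ f (trace v) = fluxForm Ω σ (solution σ f) v := by
  have hex : ∃ ℓ : StrongDual ℝ (X Ω p), ∀ v : W Ω p,
      ℓ (trace v) = fluxForm Ω σ (solution σ f) v := by
    obtain ⟨L, hL⟩ := hσ.exists_fluxForm_eq (solution σ f)
    refine ⟨(sobolevZero Ω p).liftQL L fun w hw => ?_, fun v => ?_⟩
    · exact (hL w).trans ((hσ.isMinimizer_solution hn hΩb f).fluxForm_eq_zero hσ hw)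
    · exact hL v
  exact Classical.epsilon_spec hex v

theorem dnMap_self (hσ : LinftyPlus Ω σ) (hn : 0 < n) (hΩb : Bornology.IsBounded Ω) (f : X Ω p) :
    dnMap Ω p σ f f = energy σ (solution σ f) := by
  have h := dnMap_trace hσ hn hΩb f (solution σ f)
  rw [(hσ.isMinimizer_solution hn hΩb f).1, fluxForm_self] at h
  exact h

/-! ### Monotonicity -/

/-- The upper monotonicity inequality. -/
theorem dnMap_sub_le (hσ : LinftyPlus Ω σ) (hn : 0 < n) (hΩb : Bornology.IsBounded Ω)
    (f : X Ω p) :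
    dnMap Ω p σ f f - dnMap Ω p (fun _ => 1) f f ≤
      ∫ x in Ω, (σ x - 1) * ‖(solution (fun _ => 1) f).grad x‖ ^ p := by
  rw [dnMap_self hσ hn hΩb, dnMap_self linftyPlus_one hn hΩb]
  have h := (hσ.isMinimizer_solution hn hΩb f).2 _
    (linftyPlus_one.isMinimizer_solution hn hΩb f).1
  simp only [sub_mul, one_mul]
  rw [integral_sub (hσ.integrable_energy _) (W.integrable_grad _)]
  simp only [energy, one_mul] at h ⊢
  linarith

theorem LinftyPlus.integrable_one_sub_rpow_mul (hσ : LinftyPlus Ω σ) {g : E n → ℝ}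
    (hg : Integrable g (volume.restrict Ω)) {q : ℝ} (hq : q ≤ 0) :
    Integrable (fun x => (1 - σ x ^ q) * g x) (volume.restrict Ω) := by
  obtain ⟨c, M, hc, -, h⟩ := hσ.exists_bounds
  refine hg.bdd_mul (c := 1 + c ^ q) ?_ (h.mono fun x hx => ?_)
  · exact (aemeasurable_const.sub (hσ.1.1.aemeasurable.pow_const q)).aestronglyMeasurable
  · have hx0 : 0 < σ x := hc.trans_le hx.1
    have h1 := Real.rpow_le_rpow_of_nonpos hc hx.1 hq
    have h2 : 0 < σ x ^ q := by positivity
    rw [Real.norm_eq_abs, abs_le]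
    constructor <;> linarith

/-- The lower monotonicity inequality. -/
theorem le_dnMap_sub (hσ : LinftyPlus Ω σ) (hn : 0 < n) (hΩb : Bornology.IsBounded Ω)
    (f : X Ω p) :
    (p - 1) * ∫ x in Ω, (1 - σ x ^ (-(1 / (p - 1)))) * ‖(solution (fun _ => 1) f).grad x‖ ^ p ≤
      dnMap Ω p σ f f - dnMap Ω p (fun _ => 1) f f := by
  have hp1 : 0 < p - 1 := sub_pos.2 hp.out
  have hu := hσ.isMinimizer_solution hn hΩb f
  have h1 := linftyPlus_one.isMinimizer_solution hn hΩb f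
  -- Both solutions have boundary value `f`, so the flux of `v` may be tested with the solution for
  -- `σ` in place of `v`.
  have hcross : fluxForm Ω (fun _ => 1) (solution (fun _ => 1) f) (solution σ f) =
      dnMap Ω p (fun _ => 1) f f := by
    rw [← dnMap_trace linftyPlus_one hn hΩb, hu.1]
  rw [dnMap_self hσ hn hΩb]
  set u := solution σ f
  set v := solution (fun _ => 1) f
  have hE1 : dnMap Ω p (fun _ => 1) f f = ∫ x in Ω, ‖v.grad x‖ ^ p := by
    rw [dnMap_self linftyPlus_one hn hΩb]
    simp only [energy, one_mul]
    rfl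
  have hq : -(1 / (p - 1)) ≤ 0 := neg_nonpos.2 (by positivity)
  have i1 := hσ.integrable_one_sub_rpow_mul v.integrable_grad hq
  have i2 := linftyPlus_one.integrable_flux v u
  have i3 : Integrable (fun x => ‖v.grad x‖ ^ p - (1 - σ x ^ (-(1 / (p - 1)))) * ‖v.grad x‖ ^ p)
    (volume.restrict Ω) := v.integrable_grad.sub i1
  have key : p * fluxForm Ω (fun _ => 1) v u ≤
      ∫ x in Ω, (σ x * ‖u.grad x‖ ^ p + (p - 1) * (‖v.grad x‖ ^ p -
        (1 - σ x ^ (-(1 / (p - 1)))) * ‖v.grad x‖ ^ p)) := by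
    unfold fluxForm
    rw [← integral_const_mul]
    obtain ⟨c, M, hc, -, hb⟩ := hσ.exists_bounds
    refine integral_mono_ae (i2.const_mul p) ((hσ.integrable_energy u).add
      (i3.const_mul _)) (hb.mono fun x hx => ?_)
    have hy := young_weighted hp.out (hc.trans_le hx.1) (norm_nonneg (u.grad x))
      (norm_nonneg (v.grad x))
    have hi := mul_le_mul_of_nonneg_left ((le_abs_self _).trans
      (abs_norm_rpow_sub_two_mul_inner_le hp.out (v.grad x) (u.grad x))) (by linarith : 0 ≤ p)
    simp only [one_mul]
    linarith
  rw [integral_add (hσ.integrable_energy u) (i3.const_mul _),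
    integral_const_mul, integral_sub v.integrable_grad i1, hcross, hE1] at key
  rw [hE1]
  unfold energy
  linarith

end Forward

/-! ### Exponentially growing `p`-harmonic functions -/

section Profile

variable {p : ℝ}

/-- The equation is autonomous and separable. Its denominator has the explicit primitive `Z`, an
increasing bijection of the line, and the solution is `Z⁻¹(-(p-1) y)`. -/
theorem exists_angle (hp : 1 < p) : ∃ φ : ℝ → ℝ, ∀ y,
    HasDerivAt φ (-(p - 1) / ((p - 1) * Real.sin (φ y) ^ 2 + Real.cos (φ y) ^ 2)) y := by
  have hp1 : 0 < p - 1 := sub_pos.2 hp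
  let k : ℝ → ℝ := fun s => (p - 1) * Real.sin s ^ 2 + Real.cos s ^ 2
  have hk : ∀ s, 0 < k s := fun s => by
    rcases eq_or_ne (Real.cos s) 0 with h | h
    · have : Real.sin s ^ 2 = 1 := by nlinarith [Real.sin_sq_add_cos_sq s]
      simp only [k, this, h]
      nlinarith
    · have : 0 < Real.cos s ^ 2 := by positivity
      simp only [k]
      positivity
  let Z : ℝ → ℝ := fun s => p / 2 * s - (p - 2) / 2 * (Real.sin s * Real.cos s)
  have hZ : ∀ s, HasDerivAt Z (k s) s := fun s => by
    have h := ((hasDerivAt_id s).const_mul (p / 2)).sub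
      (((Real.hasDerivAt_sin s).mul (Real.hasDerivAt_cos s)).const_mul ((p - 2) / 2))
    refine h.congr_deriv ?_
    simp only [k]
    linear_combination (p / 2) * (-(Real.sin_sq_add_cos_sq s))
  have hZc : Continuous Z := continuous_iff_continuousAt.2 fun s => (hZ s).continuousAt
  have hZm : StrictMono Z := strictMono_of_hasDerivAt_pos hZ hk
  have hbd : ∀ s, |(p - 2) / 2 * (Real.sin s * Real.cos s)| ≤ |(p - 2) / 2| := fun s => by
    rw [abs_mul, abs_mul]
    exact mul_le_of_le_one_right (abs_nonneg _)
      (mul_le_one₀ (Real.abs_sin_le_one s) (abs_nonneg _) (Real.abs_cos_le_one s))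
  have htop : Tendsto Z atTop atTop := by
    refine tendsto_atTop_mono (fun s => ?_) (tendsto_atTop_add_const_right _ (-|(p - 2) / 2|)
      (tendsto_id.const_mul_atTop (by linarith : 0 < p / 2)))
    have := (abs_le.1 (hbd s)).2
    simp only [Z, id]
    linarith
  have hbot : Tendsto Z atBot atBot := by
    refine tendsto_atBot_mono (fun s => ?_) (tendsto_atBot_add_const_right _ (|(p - 2) / 2|)
      (tendsto_id.const_mul_atBot (by linarith : 0 < p / 2)))
    have := (abs_le.1 (hbd s)).1
    simp only [Z, id]
    linarith
  let ψ := hZm.orderIsoOfSurjective Z (hZc.surjective htop hbot)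
  have hψ : ∀ y, HasDerivAt ψ.symm (k (ψ.symm y))⁻¹ y := fun y =>
    HasDerivAt.of_local_left_inverse ψ.symm.continuous.continuousAt (hZ _) (hk _).ne'
      (Eventually.of_forall fun z => ψ.apply_symm_apply z)
  refine ⟨fun y => ψ.symm (-(p - 1) * y), fun y => ?_⟩
  have h := (hψ (-(p - 1) * y)).comp y ((hasDerivAt_id y).const_mul (-(p - 1)))
  refine h.congr_deriv ?_
  simp only [k]
  ring

/-- The profile of Wolff's exponential `p`-harmonic functions: `exp(s) a(t)` is `p`-harmonic in the
plane, with gradient `exp(s) (a, b)` of length `exp(s) R`. -/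
theorem exists_wolff_profile (hp : 1 < p) : ∃ a b R : ℝ → ℝ, ∃ c C : ℝ, 0 < c ∧ 0 < C ∧
    (∀ y, 0 < R y) ∧ (∀ y, a y ^ 2 + b y ^ 2 = R y ^ 2) ∧
    (∀ y, c ≤ R y ^ p ∧ R y ^ p ≤ C) ∧ (∀ y, HasDerivAt a (b y) y) ∧ Continuous b ∧
    Differentiable ℝ (fun y => R y ^ (p - 2) * a y) ∧
    ∀ y, HasDerivAt (fun y => R y ^ (p - 2) * b y) (-(p - 1) * (R y ^ (p - 2) * a y)) y := by
  have hp1 : 0 < p - 1 := sub_pos.2 hp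
  have hp0 : 0 < p := by linarith
  obtain ⟨φ, hφ⟩ := exists_angle hp
  -- In polar form `(a, b) = R (cos φ, sin φ)`, the two equations `a' = b` and `(R^(p-2) b)' =
  -- -(p-1) R^(p-2) a` give the equation for `φ` and `d(log R)/dφ = 2q sin φ cos φ`. Hence `log R =
  -- q sin² φ`, which is bounded.
  let q : ℝ := (p - 2) / (2 * (p - 1))
  let R : ℝ → ℝ := fun y => Real.exp (q * Real.sin (φ y) ^ 2)
  have hkne : ∀ y, (p - 1) * Real.sin (φ y) ^ 2 + Real.cos (φ y) ^ 2 ≠ 0 := fun y h => by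
    have h1 := Real.sin_sq_add_cos_sq (φ y)
    have h2 : 0 ≤ Real.sin (φ y) ^ 2 := by positivity
    have h3 : 0 ≤ Real.cos (φ y) ^ 2 := by positivity
    have h4 : 0 ≤ (p - 1) * Real.sin (φ y) ^ 2 := by positivity
    have h5 : (p - 1) * Real.sin (φ y) ^ 2 = 0 := by linarith
    rcases mul_eq_zero.1 h5 with h6 | h6 <;> linarith
  have hφc : Continuous φ := continuous_iff_continuousAt.2 fun y => (hφ y).continuousAt
  let D : ℝ → ℝ := fun y => -(p - 1) / ((p - 1) * Real.sin (φ y) ^ 2 + Real.cos (φ y) ^ 2)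
  have hD : ∀ y, D y * ((p - 1) * Real.sin (φ y) ^ 2 + Real.cos (φ y) ^ 2) = -(p - 1) :=
    fun y => div_mul_cancel₀ _ (hkne y)
  have hq : 2 * (p - 1) * q = p - 2 := by
    simp only [q]
    field_simp
  have hsin : ∀ y, HasDerivAt (fun y => Real.sin (φ y)) (Real.cos (φ y) * D y) y :=
    fun y => (hφ y).sin
  have hcos : ∀ y, HasDerivAt (fun y => Real.cos (φ y)) (-Real.sin (φ y) * D y) y :=
    fun y => (hφ y).cos
  have hexp : ∀ (r : ℝ) (y : ℝ), HasDerivAt (fun y => Real.exp (r * Real.sin (φ y) ^ 2))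
      (Real.exp (r * Real.sin (φ y) ^ 2) *
        (r * (2 * Real.sin (φ y) * (Real.cos (φ y) * D y)))) y := fun r y => by
    refine (((hsin y).pow 2).const_mul r).exp.congr_deriv ?_
    simp
  have hRpow : ∀ (r : ℝ) (y : ℝ), R y ^ r = Real.exp (r * q * Real.sin (φ y) ^ 2) := fun r y => by
    rw [← Real.exp_mul]
    ring_nf
  refine ⟨fun y => R y * Real.cos (φ y), fun y => R y * Real.sin (φ y), R,
    Real.exp (-(p * |q|)), Real.exp (p * |q|), Real.exp_pos _, Real.exp_pos _,
    fun y => Real.exp_pos _, fun y => ?_, fun y => ?_, fun y => ?_, ?_, ?_, fun y => ?_⟩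
  · linear_combination R y ^ 2 * Real.sin_sq_add_cos_sq (φ y)
  · have h : |p * q * Real.sin (φ y) ^ 2| ≤ p * |q| := by
      rw [abs_mul, abs_mul, abs_of_pos hp0, abs_of_nonneg (sq_nonneg (Real.sin _))]
      exact mul_le_of_le_one_right (by positivity) (Real.sin_sq_le_one _)
    rw [hRpow]
    exact ⟨Real.exp_le_exp.2 (abs_le.1 h).1, Real.exp_le_exp.2 (abs_le.1 h).2⟩
  · refine ((hexp q y).mul (hcos y)).congr_deriv ?_
    have h1 : D y * (2 * q * Real.cos (φ y) ^ 2 - 1) = 1 := by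
      refine mul_right_cancel₀ (hkne y) ?_
      linear_combination (2 * q * Real.cos (φ y) ^ 2 - 1) * hD y - Real.cos (φ y) ^ 2 * hq -
        (p - 1) * Real.sin_sq_add_cos_sq (φ y)
    simp only [R]
    linear_combination Real.exp (q * Real.sin (φ y) ^ 2) * Real.sin (φ y) * h1
  · exact (Real.continuous_exp.comp (continuous_const.mul ((Real.continuous_sin.comp hφc).pow 2))).mul
      (Real.continuous_sin.comp hφc)
  · simp only [hRpow]
    exact fun y => ((hexp ((p - 2) * q) y).differentiableAt).mul
      (((hexp q y).mul (hcos y)).differentiableAt)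
  · simp only [hRpow]
    refine ((hexp ((p - 2) * q) y).mul ((hexp q y).mul (hsin y))).congr_deriv ?_
    simp only [R, Pi.mul_apply]
    linear_combination Real.exp ((p - 2) * q * Real.sin (φ y) ^ 2) *
      Real.exp (q * Real.sin (φ y) ^ 2) * Real.cos (φ y) * (hD y + D y * Real.sin (φ y) ^ 2 * hq -
        D y * Real.sin_sq_add_cos_sq (φ y))

end Profile

/-! ### Wolff's solutions as minimizers on `Ω` -/

section Classical

variable {n : ℕ} {Ω : Set (E n)} {p : ℝ} [hp : Fact (1 < p)]

theorem memLp_of_continuous {F : Type*} [NormedAddCommGroup F] {g : E n → F} (hg : Continuous g)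
    (hΩo : IsOpen Ω) (hΩb : Bornology.IsBounded Ω) (q : ℝ≥0∞) :
    MemLp g q (volume.restrict Ω) := by
  have : IsFiniteMeasure (volume.restrict Ω) := ⟨by
    rw [Measure.restrict_apply_univ]; exact hΩb.measure_lt_top⟩
  obtain ⟨C, hC⟩ := hΩb.isCompact_closure.exists_bound_of_continuousOn hg.continuousOn
  refine MemLp.of_bound hg.aestronglyMeasurable C ?_
  exact (ae_restrict_mem hΩo.measurableSet).mono fun x hx => hC x (subset_closure hx)

theorem inner_gradient (u : E n → ℝ) (x e : E n) : inner ℝ (gradient u x) e = fderiv ℝ u x e :=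
  InnerProductSpace.toDual_symm_apply

theorem continuous_gradient {u : E n → ℝ} (hu : ContDiff ℝ 1 u) : Continuous (gradient u) :=
  (InnerProductSpace.toDual ℝ (E n)).symm.continuous.comp (hu.continuous_fderiv (by simp))

theorem IsTestFunction.fderiv_eq_zero {φ : E n → ℝ} (hφ : IsTestFunction Ω φ) {x : E n}
    (hx : x ∉ Ω) : fderiv ℝ φ x = 0 :=
  image_eq_zero_of_notMem_tsupport fun h => hx (hφ.2.2 (tsupport_fderiv_subset ℝ h))

/-- Integration by parts against a test function. -/
theorem IsTestFunction.integral_mul_fderiv {φ : E n → ℝ} (hφ : IsTestFunction Ω φ) {f : E n → ℝ}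
    (hf : Differentiable ℝ f) {e : E n} (hfe : Continuous fun x => fderiv ℝ f x e) :
    ∫ x, f x * fderiv ℝ φ x e = -∫ x, fderiv ℝ f x e * φ x := by
  refine integral_mul_fderiv_eq_neg_fderiv_mul_of_integrable ?_ ?_ ?_ (fun x _ => hf x)
    fun x _ => hφ.1.differentiable (by simp) x
  · exact (hfe.mul hφ.1.continuous).integrable_of_hasCompactSupport hφ.2.1.mul_left
  · exact (hf.continuous.mul (continuous_fderiv_test hφ e)).integrable_of_hasCompactSupport
      (hasCompactSupport_fderiv_test hφ e).mul_left
  · exact (hf.continuous.mul hφ.1.continuous).integrable_of_hasCompactSupport hφ.2.1.mul_left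

/-- A `C¹` function on the whole space restricts to an element of `W^{1,p}(Ω)`. -/
theorem exists_sobolev_of_contDiff (hΩo : IsOpen Ω) (hΩb : Bornology.IsBounded Ω) {u : E n → ℝ}
    (hu : ContDiff ℝ 1 u) : ∃ w : W Ω p, w.grad =ᵐ[volume.restrict Ω] gradient u := by
  have h1 : MemLp u (ENNReal.ofReal p) (volume.restrict Ω) :=
    memLp_of_continuous hu.continuous hΩo hΩb _
  have h2 : MemLp (gradient u) (ENNReal.ofReal p) (volume.restrict Ω) :=
    memLp_of_continuous (continuous_gradient hu) hΩo hΩb _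
  refine ⟨⟨(h1.toLp u, h2.toLp (gradient u)), fun φ hφ e => ?_⟩, h2.coeFn_toLp⟩
  have e1 : ∫ x in Ω, fderiv ℝ φ x e * h1.toLp u x = ∫ x, u x * fderiv ℝ φ x e := by
    rw [← setIntegral_eq_integral_of_support (Ω := Ω)]
    · exact integral_congr_ae (h1.coeFn_toLp.mono fun x hx => by simp only [hx, mul_comm])
    · intro x hx
      simp [hφ.fderiv_eq_zero hx]
  have e2 : ∫ x in Ω, φ x * inner ℝ (h2.toLp (gradient u) x) e =
      ∫ x, fderiv ℝ u x e * φ x := by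
    rw [← setIntegral_eq_integral_of_support (Ω := Ω)]
    · exact integral_congr_ae (h2.coeFn_toLp.mono fun x hx => by
        simp only [hx, inner_gradient, mul_comm])
    · intro x hx
      simp [hφ.eq_zero hx]
  exact e1.trans ((hφ.integral_mul_fderiv (hu.differentiable (by simp))
    ((hu.continuous_fderiv (by simp)).clm_apply continuous_const)).trans (by rw [← e2]))

/-- A classical weak solution of the `p`-Laplace equation is a minimizer. -/
theorem exists_isMinimizer_of_contDiff (hΩo : IsOpen Ω) (hΩb : Bornology.IsBounded Ω)
    {u : E n → ℝ} (hu : ContDiff ℝ 1 u)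
    (h : ∀ φ, IsTestFunction Ω φ →
      ∫ x, ‖gradient u x‖ ^ (p - 2) * inner ℝ (gradient u x) (gradient φ x) = 0) :
    ∃ w : W Ω p, IsMinimizer (fun _ => 1) (trace w) w ∧
      w.grad =ᵐ[volume.restrict Ω] gradient u := by
  obtain ⟨w, hw⟩ := exists_sobolev_of_contDiff (p := p) hΩo hΩb hu
  refine ⟨w, linftyPlus_one.isMinimizer_of_fluxForm_eq_zero fun v hv => ?_, hw⟩
  obtain ⟨φ, hφ, -, h2⟩ := hv
  rw [← h φ hφ, ← setIntegral_eq_integral_of_support (Ω := Ω)]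
  · refine integral_congr_ae ?_
    filter_upwards [hw, h2] with x hx1 hx2
    have hx3 : v.grad x = gradient φ x := hx2
    simp only [hx1, hx3, one_mul]
  · intro x hx
    rw [real_inner_comm, inner_gradient, hφ.fderiv_eq_zero hx]
    simp

/-- Wolff's solutions oscillate in a direction orthogonal to their growth. This is where `n ≥ 2`,
and not only `n > 0`, is needed. -/
theorem exists_orthogonal_norm_eq (hn : 2 ≤ n) (ξ : E n) :
    ∃ η : E n, inner ℝ ξ η = 0 ∧ ‖η‖ = ‖ξ‖ := by
  have hne : (ℝ ∙ ξ)ᗮ ≠ ⊥ := fun h => by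
    rw [Submodule.orthogonal_eq_bot_iff] at h
    have h1 := finrank_span_le_card (R := ℝ) ({ξ} : Set (E n))
    rw [h, finrank_top, finrank_euclideanSpace_fin] at h1
    simp at h1
    omega
  obtain ⟨e, he, he0⟩ := Submodule.exists_mem_ne_zero_of_ne_bot hne
  refine ⟨(‖ξ‖ / ‖e‖) • e, ?_, ?_⟩
  · rw [real_inner_smul_right, Submodule.mem_orthogonal_singleton_iff_inner_right.1 he, mul_zero]
  · rw [norm_smul, Real.norm_of_nonneg (by positivity),
      div_mul_cancel₀ _ (norm_ne_zero_iff.2 he0)]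

theorem hasFDerivAt_exp_inner_mul {g : ℝ → ℝ} {g' : ℝ} (r : ℝ) (ξ η x : E n)
    (hg : HasDerivAt g g' (inner ℝ η x)) :
    HasFDerivAt (fun x => Real.exp (r * inner ℝ ξ x) * g (inner ℝ η x))
      (Real.exp (r * inner ℝ ξ x) • (g' • innerSL ℝ η + (r * g (inner ℝ η x)) • innerSL ℝ ξ)) x := by
  have h1 : HasFDerivAt (fun x => inner ℝ ξ x) (innerSL ℝ ξ) x := (innerSL ℝ ξ).hasFDerivAt
  have h2 : HasFDerivAt (fun x => inner ℝ η x) (innerSL ℝ η) x := (innerSL ℝ η).hasFDerivAt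
  have h3 := ((h1.const_mul r).exp).mul (hg.comp_hasFDerivAt x h2)
  refine h3.congr_fderiv ?_
  ext y
  simp
  ring

/-- Wolff's `p`-harmonic functions with exponential growth in the direction `ξ`. -/
theorem exists_exponential_solution (hn : 2 ≤ n) (hΩo : IsOpen Ω) (hΩb : Bornology.IsBounded Ω) :
    ∃ c C : ℝ, 0 < c ∧ 0 < C ∧ ∀ ξ : E n, ξ ≠ 0 → ∃ w : W Ω p,
      IsMinimizer (fun _ => 1) (trace w) w ∧ ∀ᵐ x ∂(volume.restrict Ω),
        ‖ξ‖ ^ p * (c * Real.exp (p * inner ℝ x ξ)) ≤ ‖w.grad x‖ ^ p ∧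
        ‖w.grad x‖ ^ p ≤ ‖ξ‖ ^ p * (C * Real.exp (p * inner ℝ x ξ)) := by
  have hp0 : 0 < p := exponent_pos
  obtain ⟨a, b, R, c, C, hc, hC, hR, hab, hRb, ha, hb, hP, hQ⟩ := exists_wolff_profile hp.out
  refine ⟨c, C, hc, hC, fun ξ hξ => ?_⟩
  obtain ⟨η, hη, hηξ⟩ := exists_orthogonal_norm_eq hn ξ
  have hη' : inner ℝ η ξ = 0 := by rw [real_inner_comm, hη]
  have hac : Continuous a := continuous_iff_continuousAt.2 fun y => (ha y).continuousAt
  let u : E n → ℝ := fun x => Real.exp (1 * inner ℝ ξ x) * a (inner ℝ η x)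
  have hud := fun x => hasFDerivAt_exp_inner_mul 1 ξ η x (ha (inner ℝ η x))
  have hgrad : ∀ x, gradient u x = Real.exp (inner ℝ ξ x) •
      (b (inner ℝ η x) • η + a (inner ℝ η x) • ξ) := fun x => by
    refine ext_inner_right ℝ fun y => ?_
    rw [inner_gradient, (hud x).fderiv]
    simp [inner_add_left, real_inner_smul_left]
  have hu : ContDiff ℝ 1 u := by
    rw [contDiff_one_iff_fderiv]
    refine ⟨fun x => (hud x).differentiableAt, ?_⟩
    have : fderiv ℝ u = fun x => _ := funext fun x => (hud x).fderiv
    rw [this]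
    fun_prop
  have hnorm : ∀ x, ‖gradient u x‖ = Real.exp (inner ℝ ξ x) * (‖ξ‖ * R (inner ℝ η x)) := fun x => by
    rw [hgrad, norm_smul, Real.norm_of_nonneg (Real.exp_pos _).le]
    congr 1
    refine (pow_left_inj₀ (norm_nonneg _) (mul_nonneg (norm_nonneg _) (hR _).le) two_ne_zero).1 ?_
    rw [norm_add_sq_real, norm_smul, norm_smul, real_inner_smul_left, real_inner_smul_right, hη',
      mul_pow, mul_pow, mul_pow, hηξ, ← hab, Real.norm_eq_abs, Real.norm_eq_abs, sq_abs, sq_abs]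
    ring
  have hsol : ∀ φ, IsTestFunction Ω φ →
      ∫ x, ‖gradient u x‖ ^ (p - 2) * inner ℝ (gradient u x) (gradient φ x) = 0 := by
    intro φ hφ
    -- Up to the factor `‖ξ‖^(p-2)` the flux of `u` is `f ξ + g η`. Since `ξ` and `η` are orthogonal
    -- of equal length, the profile equation says that the derivative of `f` along `ξ` cancels that
    -- of `g` along `η`.
    let f : E n → ℝ := fun x =>
      Real.exp ((p - 1) * inner ℝ ξ x) * (R (inner ℝ η x) ^ (p - 2) * a (inner ℝ η x))
    let g : E n → ℝ := fun x =>
      Real.exp ((p - 1) * inner ℝ ξ x) * (R (inner ℝ η x) ^ (p - 2) * b (inner ℝ η x))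
    have hfd : ∀ x, HasFDerivAt f _ x := fun x =>
      hasFDerivAt_exp_inner_mul (p - 1) ξ η x (hP (inner ℝ η x)).hasDerivAt
    have hgd : ∀ x, HasFDerivAt g _ x := fun x =>
      hasFDerivAt_exp_inner_mul (p - 1) ξ η x (hQ (inner ℝ η x))
    have hfc : Continuous f := continuous_iff_continuousAt.2 fun x => (hfd x).continuousAt
    have hgc : Continuous g := continuous_iff_continuousAt.2 fun x => (hgd x).continuousAt
    have hfξ : ∀ x, fderiv ℝ f x ξ = (p - 1) * ‖ξ‖ ^ 2 * f x := fun x => by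
      rw [(hfd x).fderiv]
      simp [hη', f]
      ring
    have hgη : ∀ x, fderiv ℝ g x η = -((p - 1) * ‖ξ‖ ^ 2 * f x) := fun x => by
      rw [(hgd x).fderiv]
      simp [hη, f, hηξ]
      ring
    have hif := hφ.integral_mul_fderiv (f := f) (e := ξ) (fun x => (hfd x).differentiableAt)
      (by simp only [hfξ]; fun_prop)
    have hig := hφ.integral_mul_fderiv (f := g) (e := η) (fun x => (hgd x).differentiableAt)
      (by simp only [hgη]; fun_prop)
    have hflux : ∀ x, ‖gradient u x‖ ^ (p - 2) * inner ℝ (gradient u x) (gradient φ x) =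
        ‖ξ‖ ^ (p - 2) * (f x * fderiv ℝ φ x ξ + g x * fderiv ℝ φ x η) := fun x => by
      rw [hnorm, Real.mul_rpow (Real.exp_pos _).le (mul_nonneg (norm_nonneg _) (hR _).le),
        Real.mul_rpow (norm_nonneg _) (hR _).le, hgrad, real_inner_comm (gradient φ x), inner_gradient,
        ← Real.exp_mul]
      have : Real.exp ((p - 1) * inner ℝ ξ x) =
          Real.exp (inner ℝ ξ x * (p - 2)) * Real.exp (inner ℝ ξ x) := by
        rw [← Real.exp_add]
        ring_nf
      simp only [f, g, this, map_smul, map_add, smul_eq_mul]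
      ring
    simp only [hflux]
    rw [integral_const_mul, integral_add, hif, hig]
    · simp only [hfξ, hgη, neg_mul]
      rw [integral_neg]
      ring
    · exact (hfc.mul (continuous_fderiv_test hφ ξ)).integrable_of_hasCompactSupport
        (hasCompactSupport_fderiv_test hφ ξ).mul_left
    · exact (hgc.mul (continuous_fderiv_test hφ η)).integrable_of_hasCompactSupport
        (hasCompactSupport_fderiv_test hφ η).mul_left
  obtain ⟨w, hw, hwg⟩ := exists_isMinimizer_of_contDiff (p := p) hΩo hΩb hu hsol
  refine ⟨w, hw, hwg.mono fun x hx => ?_⟩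
  rw [hx, hnorm, Real.mul_rpow (Real.exp_pos _).le (mul_nonneg (norm_nonneg _) (hR _).le),
    Real.mul_rpow (norm_nonneg _) (hR _).le, ← Real.exp_mul, mul_comm p, real_inner_comm ξ x]
  have h1 := hRb (inner ℝ η x)
  have h2 : 0 ≤ ‖ξ‖ ^ p * Real.exp (inner ℝ ξ x * p) := by positivity
  constructor
  · have := mul_le_mul_of_nonneg_left h1.1 h2
    linarith
  · have := mul_le_mul_of_nonneg_left h1.2 h2
    linarith

end Classical

/-! ### Essential supports, half-spaces and density points -/

section Geometry

variable {n : ℕ} {Ω : Set (E n)}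

theorem isClosed_halfSpace (ρ : E n) (t : ℝ) : IsClosed (halfSpace ρ t) :=
  isClosed_le (continuous_id.inner continuous_const) continuous_const

/-- By the Lindelöf property the union of the open null sets of `f` is a countable one, so `f = 0`
a.e. off its essential support. Conversely `Ω` minus a closed half-space is open, hence one of the
sets removed. -/
theorem volume_essSupp_diff_halfSpace_eq_zero_iff (hΩo : IsOpen Ω) {f : E n → ℝ} {ρ : E n}
    {t : ℝ} : volume (essSupp Ω f \ halfSpace ρ t) = 0 ↔
      ∀ᵐ x ∂(volume.restrict Ω), x ∉ halfSpace ρ t → f x = 0 := by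
  have hO : IsOpen (Ω \ halfSpace ρ t) := hΩo.sdiff (isClosed_halfSpace ρ t)
  constructor
  · intro h
    set S : Set (Set (E n)) := {O | IsOpen O ∧ O ⊆ Ω ∧ ∀ᵐ x ∂(volume.restrict O), f x = 0} with hS
    obtain ⟨T, hTc, hTS, hT⟩ := TopologicalSpace.isOpen_sUnion_countable S fun O hO => hO.1
    have h1 : ∀ᵐ x, ∀ O ∈ T, x ∈ O → f x = 0 := by
      rw [ae_ball_iff hTc]
      intro O hO
      exact (ae_restrict_iff' (hTS hO).1.measurableSet).1 (hTS hO).2.2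
    rw [ae_restrict_iff' hΩo.measurableSet]
    filter_upwards [h1, measure_eq_zero_iff_ae_notMem.1 h] with x hx hx' hxΩ hxH
    by_contra hne
    refine hx' ⟨⟨hxΩ, fun hxS => ?_⟩, hxH⟩
    change x ∈ ⋃₀ S at hxS
    rw [← hT] at hxS
    obtain ⟨O, hO, hxO⟩ := hxS
    exact hne (hx O hO hxO)
  · intro h
    have : essSupp Ω f \ halfSpace ρ t = ∅ := by
      refine eq_empty_of_forall_notMem fun x hx => hx.1.2 ?_
      refine ⟨Ω \ halfSpace ρ t, ⟨hO, sdiff_subset, ?_⟩, hx.1.1, hx.2⟩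
      rw [ae_restrict_iff' hΩo.measurableSet] at h
      rw [ae_restrict_iff' hO.measurableSet]
      exact h.mono fun x hx hx' => hx hx'.1 hx'.2
    rw [this, measure_empty]

theorem essConvexHull_congr {A B : Set (E n)}
    (h : ∀ ρ t, volume (A \ halfSpace ρ t) = 0 ↔ volume (B \ halfSpace ρ t) = 0) :
    essConvexHull A = essConvexHull B := by
  simp only [essConvexHull, h]

theorem volume_diff_measureInterior {B : Set (E n)} (hB : MeasurableSet B) :
    volume (B \ measureInterior B) = 0 := by
  rw [measure_eq_zero_iff_ae_notMem]
  filter_upwards [Besicovitch.ae_tendsto_measure_inter_div_of_measurableSet volume hB]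
    with x hx hxB
  refine hxB.2 ⟨hxB.1, ?_⟩
  rw [indicator_of_mem hxB.1, Pi.one_apply] at hx
  refine hx.congr' ?_
  filter_upwards [self_mem_nhdsWithin] with r hr
  -- The density theorem uses closed balls and `measureInterior` open ones; spheres are null.
  have hv : volume (Metric.closedBall x r) = volume (Metric.ball x r) := by
    rw [Measure.addHaar_closedBall _ _ (le_of_lt hr), Measure.addHaar_ball_of_pos _ _ hr]
  have h0 : (B ∩ Metric.closedBall x r : Set (E n)) =ᵐ[volume] (B ∩ Metric.ball x r : Set (E n)) :=
    (ae_eq_refl B).inter (ae_eq_of_subset_of_measure_ge Metric.ball_subset_closedBall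
      hv.le
      measurableSet_ball.nullMeasurableSet measure_closedBall_lt_top.ne).symm
  rw [measure_congr h0, hv]

/-- A point off `H` has a ball missing `H`, where `B` is null and has density `0`. The inclusion is
exact, not merely up to a null set, so it survives the uncountable union over all marked sets. -/
theorem measureInterior_subset_of_isClosed {B H : Set (E n)} (hH : IsClosed H)
    (h : volume (B \ H) = 0) : measureInterior B ⊆ H := by
  intro x hx
  by_contra hxH
  obtain ⟨ε, hε, hball⟩ := Metric.isOpen_iff.1 hH.isOpen_compl x hxH
  have h0 : (fun r : ℝ => volume (B ∩ Metric.ball x r) / volume (Metric.ball x r)) =ᶠ[𝓝[>] 0]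
      fun _ => 0 := by
    filter_upwards [Ioo_mem_nhdsGT hε] with r hr
    have hsub : B ∩ Metric.ball x r ⊆ B \ H := fun y hy =>
      ⟨hy.1, hball (Metric.ball_subset_ball hr.2.le hy.2)⟩
    have : volume (B ∩ Metric.ball x r) = 0 := measure_mono_null hsub h
    rw [this, ENNReal.zero_div]
  exact zero_ne_one (tendsto_nhds_unique (tendsto_const_nhds.congr' h0.symm) hx.2)

end Geometry

/-! ### The monotonicity tests -/

section Tests

variable {n : ℕ} {Ω : Set (E n)} {p : ℝ} [hp : Fact (1 < p)] {σ : E n → ℝ}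

/-- The half-space test: a test operator dominated by the energy in a half-space belongs to a set
that lies in that half-space up to a null set. -/
theorem volume_diff_halfSpace_eq_zero (hn : 2 ≤ n) (hΩo : IsOpen Ω)
    (hΩb : Bornology.IsBounded Ω) {B : Set (E n)} (hBΩ : B ⊆ Ω) (hB : NullMeasurableSet B volume)
    {ρ : E n} (hρ : ρ ≠ 0) {t α M : ℝ} (hα : 0 < α) (hM : 0 ≤ M)
    (h : ∀ f : X Ω p, α * testOp Ω p B f f ≤
      M * ∫ x in Ω ∩ halfSpace ρ t, ‖(solution (fun _ => 1) f).grad x‖ ^ p) :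
    volume (B \ halfSpace ρ t) = 0 := by
  have hp0 : 0 < p := exponent_pos
  obtain ⟨c, C, hc, hC, hsol⟩ := exists_exponential_solution (p := p) hn hΩo hΩb
  -- A margin `δ` beyond the half-space makes the two exponential rates differ; the margins
  -- `1/(k+1)` then exhaust `B \ halfSpace ρ t`.
  let B' : ℝ → Set (E n) := fun δ => B ∩ {x | t + δ < inner ℝ x ρ}
  have hB'm : ∀ δ, NullMeasurableSet (B' δ) volume := fun δ =>
    hB.inter (isOpen_lt continuous_const (continuous_id.inner continuous_const)).nullMeasurableSet
  have hfin : ∀ A : Set (E n), A ⊆ Ω → volume A ≠ ⊤ := fun A hA =>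
    (hΩb.subset hA).measure_lt_top.ne
  have key : ∀ δ : ℝ, 0 < δ → volume (B' δ) = 0 := by
    intro δ hδ
    by_contra hne
    have hB'Ω : B' δ ⊆ Ω := inter_subset_left.trans hBΩ
    have hm : 0 < volume.real (B' δ) := ENNReal.toReal_pos hne (hfin _ hB'Ω)
    set m := volume.real (B' δ)
    set V := volume.real (Ω ∩ halfSpace ρ t)
    have hV : 0 ≤ V := measureReal_nonneg
    have hbound : ∀ τ : ℝ, 0 < τ →
        α * (c * m) * Real.exp (p * τ * δ) ≤ M * (C * V) := by
      intro τ hτ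
      obtain ⟨w, hw, hwb⟩ := hsol (τ • ρ) (smul_ne_zero hτ.ne' hρ)
      have hwf := h (trace w)
      rw [testOp_self, linftyPlus_one.solution_eq (by omega) hΩb hw] at hwf
      have hN : 0 < ‖τ • ρ‖ ^ p := by
        have := norm_pos_iff.2 (smul_ne_zero hτ.ne' hρ)
        positivity
      have hint : IntegrableOn (fun x => ‖w.grad x‖ ^ p) Ω := w.integrable_grad
      have h1 : ‖τ • ρ‖ ^ p * (c * Real.exp (p * (τ * (t + δ)))) * m ≤
          ∫ x in B, ‖w.grad x‖ ^ p := by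
        have hB'B : B' δ ⊆ B := inter_subset_left
        refine le_trans ?_ (setIntegral_mono_set (hint.mono_set hBΩ)
          (Eventually.of_forall fun x => by positivity) hB'B.eventuallyLE)
        refine le_trans (le_of_eq ?_) (setIntegral_mono_on_ae₀ (s := B' δ)
          (f := fun _ => ‖τ • ρ‖ ^ p * (c * Real.exp (p * (τ * (t + δ)))))
          (integrableOn_const (hfin _ hB'Ω)) (hint.mono_set hB'Ω) (hB'm δ) ?_)
        · rw [setIntegral_const, smul_eq_mul, mul_comm]
        · rw [ae_restrict_iff' hΩo.measurableSet] at hwb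
          filter_upwards [hwb] with x hx hxB
          refine le_trans ?_ (hx (hB'Ω hxB)).1
          rw [real_inner_smul_right]
          have : t + δ < inner ℝ x ρ := hxB.2
          gcongr
      have h2 : ∫ x in Ω ∩ halfSpace ρ t, ‖w.grad x‖ ^ p ≤
          ‖τ • ρ‖ ^ p * (C * Real.exp (p * (τ * t))) * V := by
        have hms : MeasurableSet (Ω ∩ halfSpace ρ t) :=
          hΩo.measurableSet.inter (isClosed_halfSpace ρ t).measurableSet
        refine (setIntegral_mono_on_ae₀
          (g := fun _ => ‖τ • ρ‖ ^ p * (C * Real.exp (p * (τ * t))))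
          (hint.mono_set inter_subset_left) (integrableOn_const (hfin _ inter_subset_left))
          hms.nullMeasurableSet ?_).trans (le_of_eq ?_)
        · rw [ae_restrict_iff' hΩo.measurableSet] at hwb
          filter_upwards [hwb] with x hx hxB
          refine (hx hxB.1).2.trans ?_
          rw [real_inner_smul_right]
          have : inner ℝ x ρ ≤ t := hxB.2
          gcongr
        · rw [setIntegral_const, smul_eq_mul, mul_comm]
      have h3 := (mul_le_mul_of_nonneg_left h1 hα.le).trans
        (hwf.trans (mul_le_mul_of_nonneg_left h2 hM))
      have h4 : Real.exp (p * (τ * (t + δ))) = Real.exp (p * (τ * t)) * Real.exp (p * τ * δ) := by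
        rw [← Real.exp_add]
        ring_nf
      rw [h4] at h3
      refine le_of_mul_le_mul_left (a := ‖τ • ρ‖ ^ p * Real.exp (p * (τ * t))) ?_ (by positivity)
      linarith
    have hpos : 0 < α * (c * m) := by positivity
    set K := M * (C * V)
    have hK : 0 ≤ K := by positivity
    -- This `τ` makes the exponent `K/(αcm) + 1`; then `exp x ≥ x + 1` bounds the left side below by
    -- `K + 2αcm > K`.
    have hb := hbound ((K / (α * (c * m)) + 1) / (p * δ)) (by positivity)
    have he : p * ((K / (α * (c * m)) + 1) / (p * δ)) * δ = K / (α * (c * m)) + 1 := by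
      field_simp
    rw [he] at hb
    have h5 := mul_le_mul_of_nonneg_left (Real.add_one_le_exp (K / (α * (c * m)) + 1)) hpos.le
    have h6 : α * (c * m) * (K / (α * (c * m)) + 1 + 1) = K + 2 * (α * (c * m)) := by
      field_simp
      ring
    linarith
  have hsub : B \ halfSpace ρ t ⊆ ⋃ k : ℕ, B' (1 / ((k : ℝ) + 1)) := by
    rintro x ⟨hxB, hxH⟩
    have hx : t < inner ℝ x ρ := not_le.1 hxH
    obtain ⟨k, hk⟩ := exists_nat_one_div_lt (sub_pos.2 hx)
    exact mem_iUnion.2 ⟨k, hxB, show t + _ < _ by linarith⟩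
  exact measure_mono_null hsub (measure_iUnion_null fun k => key _ (by positivity))

theorem volume_eq_zero_of_testOp_nonpos (hn : 2 ≤ n) (hΩo : IsOpen Ω)
    (hΩb : Bornology.IsBounded Ω) {B : Set (E n)} (hBΩ : B ⊆ Ω) (hB : NullMeasurableSet B volume)
    {α : ℝ} (hα : 0 < α) (h : ∀ f : X Ω p, α * testOp Ω p B f f ≤ 0) : volume B = 0 := by
  obtain ⟨r, hr0, hr⟩ := hΩb.exists_pos_norm_le
  let ρ : E n := EuclideanSpace.single ⟨0, by omega⟩ 1
  have hρ1 : ‖ρ‖ = 1 := by simp [ρ]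
  have hρ : ρ ≠ 0 := norm_ne_zero_iff.1 (by rw [hρ1]; exact one_ne_zero)
  -- The half-space test with `M = 0` and a half-space that misses `Ω`.
  have h0 := volume_diff_halfSpace_eq_zero (t := -r - 1) hn hΩo hΩb hBΩ hB hρ hα le_rfl
    fun f => by simpa using h f
  rwa [sdiff_eq_left.2] at h0
  rw [Set.disjoint_left]
  intro x hxB hxH
  have h1 := (abs_le.1 (abs_real_inner_le_norm x ρ)).1
  have h2 : inner ℝ x ρ ≤ -r - 1 := hxH
  have h3 := hr x (hBΩ hxB)
  rw [hρ1, mul_one] at h1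
  linarith

/-- Two-sided control of the quadratic form `d` by the set where `σ ≠ 1`. -/
structure IsControlled (Ω : Set (E n)) (p : ℝ) [Fact (1 < p)] (σ : E n → ℝ) (d : X Ω p → ℝ) :
    Prop where
  lower : ∀ δ : ℝ, 0 < δ → ∃ α : ℝ, 0 < α ∧ ∀ B : Set (E n), MeasurableSet B → B ⊆ Ω →
    (∀ᵐ x ∂(volume.restrict Ω), x ∈ B → δ ≤ |σ x - 1|) → ∀ f, α * testOp Ω p B f f ≤ d f
  upper : ∃ M : ℝ, 0 ≤ M ∧ ∀ A : Set (E n), MeasurableSet A →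
    (∀ᵐ x ∂(volume.restrict Ω), x ∉ A → σ x = 1) → ∀ f,
      d f ≤ M * ∫ x in Ω ∩ A, ‖(solution (fun _ => 1) f).grad x‖ ^ p

theorem setIntegral_indicator_const_mul {A : Set (E n)} (hA : MeasurableSet A) (M : ℝ)
    (g : E n → ℝ) :
    ∫ x in Ω, A.indicator (fun _ => M) x * g x = M * ∫ x in Ω ∩ A, g x := by
  rw [← integral_const_mul, ← setIntegral_indicator hA]
  refine integral_congr_ae (Eventually.of_forall fun x => ?_)
  by_cases hx : x ∈ A <;> simp [hx]

theorem integrable_indicator_const_mul {A : Set (E n)} (hA : MeasurableSet A) (M : ℝ)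
    {g : E n → ℝ} (hg : Integrable g (volume.restrict Ω)) :
    Integrable (fun x => A.indicator (fun _ => M) x * g x) (volume.restrict Ω) := by
  refine ((hg.const_mul M).indicator hA).congr (Eventually.of_forall fun x => ?_)
  by_cases hx : x ∈ A <;> simp [hx]

/-- If `d` lies between the weighted energies with weights `h` and `k`, and these weights are
controlled by `|σ - 1|`, then `d` is controlled. -/
theorem isControlled_of_weights {d : X Ω p → ℝ} {h k : E n → ℝ} {M : ℝ} (hM : 0 ≤ M)
    (hh : ∀ u : W Ω p, Integrable (fun x => h x * ‖u.grad x‖ ^ p) (volume.restrict Ω))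
    (hk : ∀ u : W Ω p, Integrable (fun x => k x * ‖u.grad x‖ ^ p) (volume.restrict Ω))
    (hd : ∀ f, ∫ x in Ω, h x * ‖(solution (fun _ => 1) f).grad x‖ ^ p ≤ d f)
    (dk : ∀ f, d f ≤ ∫ x in Ω, k x * ‖(solution (fun _ => 1) f).grad x‖ ^ p)
    (h0 : ∀ᵐ x ∂(volume.restrict Ω), 0 ≤ h x)
    (hδ : ∀ δ : ℝ, 0 < δ → ∃ α : ℝ, 0 < α ∧ ∀ᵐ x ∂(volume.restrict Ω),
      δ ≤ |σ x - 1| → α ≤ h x)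
    (kM : ∀ᵐ x ∂(volume.restrict Ω), k x ≤ M)
    (k0 : ∀ᵐ x ∂(volume.restrict Ω), σ x = 1 → k x ≤ 0) : IsControlled Ω p σ d := by
  refine ⟨fun δ hδ0 => ?_, M, hM, fun A hA hAσ f => (dk f).trans ?_⟩
  · obtain ⟨α, hα, hle⟩ := hδ δ hδ0
    refine ⟨α, hα, fun B hB hBΩ hBσ f => le_trans ?_ (hd f)⟩
    have hint := setIntegral_indicator_const_mul (Ω := Ω) hB α
      fun x => ‖(solution (fun _ => 1) f).grad x‖ ^ p
    rw [inter_eq_right.2 hBΩ] at hint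
    rw [testOp_self, ← hint]
    refine integral_mono_ae (integrable_indicator_const_mul hB α (W.integrable_grad _)) (hh _) ?_
    filter_upwards [h0, hle, hBσ] with x h1 h2 h3
    refine mul_le_mul_of_nonneg_right ?_ (by positivity)
    by_cases hx : x ∈ B
    · simpa [hx] using h2 (h3 hx)
    · simpa [hx] using h1
  · rw [← setIntegral_indicator_const_mul hA]
    refine integral_mono_ae (hk _) (integrable_indicator_const_mul hA M (W.integrable_grad _)) ?_
    filter_upwards [kM, k0, hAσ] with x h1 h2 h3
    refine mul_le_mul_of_nonneg_right ?_ (by positivity)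
    by_cases hx : x ∈ A
    · simpa [hx] using h1
    · simpa [hx] using h2 (h3 hx)

theorem isControlled_of_one_le (hσ : LinftyPlus Ω σ) (hn : 0 < n) (hΩb : Bornology.IsBounded Ω)
    (h1 : ∀ᵐ x ∂(volume.restrict Ω), 1 ≤ σ x) :
    IsControlled Ω p σ fun f => dnMap Ω p σ f f - dnMap Ω p (fun _ => 1) f f := by
  have hp1 : 0 < p - 1 := sub_pos.2 hp.out
  have hq : -(1 / (p - 1)) < 0 := neg_neg_of_pos (by positivity)
  obtain ⟨c, M, hc, hM, hb⟩ := hσ.exists_bounds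
  refine isControlled_of_weights (h := fun x => (p - 1) * (1 - σ x ^ (-(1 / (p - 1)))))
    (k := fun x => σ x - 1) hM.le (fun u => ?_) (fun u => ?_) (fun f => ?_)
    (dnMap_sub_le hσ hn hΩb) ?_ (fun δ hδ => ?_) ?_ ?_
  · simp only [mul_assoc]
    exact (hσ.integrable_one_sub_rpow_mul u.integrable_grad hq.le).const_mul _
  · simp only [sub_mul, one_mul]
    exact (hσ.integrable_energy u).sub u.integrable_grad
  · simp only [mul_assoc]
    rw [integral_const_mul]
    exact le_dnMap_sub hσ hn hΩb f
  · filter_upwards [h1] with x hx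
    exact mul_nonneg hp1.le (sub_nonneg.2 (Real.rpow_le_one_of_one_le_of_nonpos hx hq.le))
  -- The lower weight increases with `σ`; this is its value at `σ = 1 + δ`.
  · refine ⟨(p - 1) * (1 - (1 + δ) ^ (-(1 / (p - 1)))), mul_pos hp1 (sub_pos.2
      (Real.rpow_lt_one_of_one_lt_of_neg (by linarith) hq)), ?_⟩
    filter_upwards [h1] with x hx hxδ
    rw [abs_of_nonneg (sub_nonneg.2 hx)] at hxδ
    have := Real.rpow_le_rpow_of_nonpos (by linarith : 0 < 1 + δ)
      (by linarith : 1 + δ ≤ σ x) hq.le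
    exact mul_le_mul_of_nonneg_left (by linarith) hp1.le
  · filter_upwards [hb] with x hx
    linarith [hx.2.1]
  · exact Eventually.of_forall fun x hx => by simp [hx]

/-- With the sign reversed the two monotonicity inequalities exchange roles. The upper weight now
contains `σ^(-1/(p-1))` and is bounded because `σ ≥ c > 0`. -/
theorem isControlled_of_le_one (hσ : LinftyPlus Ω σ) (hn : 0 < n) (hΩb : Bornology.IsBounded Ω)
    (h1 : ∀ᵐ x ∂(volume.restrict Ω), σ x ≤ 1) :
    IsControlled Ω p σ fun f => dnMap Ω p (fun _ => 1) f f - dnMap Ω p σ f f := by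
  have hp1 : 0 < p - 1 := sub_pos.2 hp.out
  have hq : -(1 / (p - 1)) ≤ 0 := neg_nonpos.2 (by positivity)
  obtain ⟨c, M, hc, hM, hb⟩ := hσ.exists_bounds
  have hi : ∀ u : W Ω p, Integrable (fun x => (σ x - 1) * ‖u.grad x‖ ^ p)
      (volume.restrict Ω) := fun u => by
    simp only [sub_mul, one_mul]
    exact (hσ.integrable_energy u).sub u.integrable_grad
  refine isControlled_of_weights (h := fun x => -(σ x - 1))
    (k := fun x => -(p - 1) * (1 - σ x ^ (-(1 / (p - 1)))))
    (M := (p - 1) * c ^ (-(1 / (p - 1)))) (by positivity)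
    (fun u => ?_) (fun u => ?_) (fun f => ?_) (fun f => ?_) ?_ (fun δ hδ => ?_) ?_ ?_
  · simp only [neg_mul]
    exact (hi u).neg
  · simp only [mul_assoc]
    exact (hσ.integrable_one_sub_rpow_mul u.integrable_grad hq).const_mul _
  · simp only [neg_mul]
    rw [integral_neg]
    linarith [dnMap_sub_le hσ hn hΩb f]
  · simp only [mul_assoc]
    rw [integral_const_mul]
    linarith [le_dnMap_sub hσ hn hΩb f]
  · filter_upwards [h1] with x hx
    linarith
  · refine ⟨δ, hδ, ?_⟩
    filter_upwards [h1] with x hx hxδ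
    rwa [abs_of_nonpos (by linarith)] at hxδ
  · filter_upwards [hb] with x hx
    have := Real.rpow_le_rpow_of_nonpos hc hx.1 hq
    have h2 := mul_le_mul_of_nonneg_left this hp1.le
    linarith
  · exact Eventually.of_forall fun x hx => by simp [hx]

theorem IsControlled.nonneg {d : X Ω p → ℝ} (h : IsControlled Ω p σ d) (f : X Ω p) : 0 ≤ d f := by
  obtain ⟨α, -, hα⟩ := h.lower 1 one_pos
  simpa [testOp_self] using hα ∅ MeasurableSet.empty (empty_subset _) (by simp) f

/-- If every measurable set on which `|σ - 1|` is bounded below is null outside `H`, then `σ = 1`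
almost everywhere outside `H`. -/
theorem ae_eq_one_of_forall_level (hΩo : IsOpen Ω)
    (hσ : AEStronglyMeasurable σ (volume.restrict Ω)) {H : Set (E n)} (hH : MeasurableSet H)
    (h : ∀ δ : ℝ, 0 < δ → ∀ B : Set (E n), MeasurableSet B → B ⊆ Ω \ H →
      (∀ᵐ x ∂(volume.restrict Ω), x ∈ B → δ ≤ |σ x - 1|) → volume B = 0) :
    ∀ᵐ x ∂(volume.restrict Ω), x ∉ H → σ x = 1 := by
  -- Countably many thresholds suffice, and the measurable representative of `σ` makes the level
  -- sets measurable.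
  let B : ℕ → Set (E n) := fun k => (Ω \ H) ∩ {x | 1 / ((k : ℝ) + 1) ≤ |hσ.mk σ x - 1|}
  have hB : ∀ k, volume (B k) = 0 := fun k => by
    refine h (1 / ((k : ℝ) + 1)) (by positivity) (B k) ?_ inter_subset_left ?_
    · refine (hΩo.measurableSet.diff hH).inter (measurableSet_le measurable_const ?_)
      exact (hσ.stronglyMeasurable_mk.measurable.sub_const 1).abs
    · filter_upwards [hσ.ae_eq_mk] with x hx hxB
      rw [hx]
      exact hxB.2
  have hU := measure_eq_zero_iff_ae_notMem.1 (measure_iUnion_null hB)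
  filter_upwards [hσ.ae_eq_mk, ae_restrict_of_ae hU, ae_restrict_mem hΩo.measurableSet]
    with x hx hxU hxΩ hxH
  by_contra hne
  have hpos : 0 < |hσ.mk σ x - 1| := abs_pos.2 (sub_ne_zero.2 (by rwa [← hx]))
  obtain ⟨k, hk⟩ := exists_nat_one_div_lt hpos
  exact hxU (mem_iUnion.2 ⟨k, ⟨hxΩ, hxH⟩, hk.le⟩)

theorem IsControlled.ae_eq_one (hn : 2 ≤ n) (hΩo : IsOpen Ω) (hΩb : Bornology.IsBounded Ω)
    (hσ : LinftyPlus Ω σ) {d : X Ω p → ℝ} (h : IsControlled Ω p σ d) (hd : ∀ f, d f ≤ 0) :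
    ∀ᵐ x ∂(volume.restrict Ω), σ x = 1 := by
  have := ae_eq_one_of_forall_level hΩo hσ.1.1 MeasurableSet.empty fun δ hδ B hB hBΩ hBσ => by
    obtain ⟨α, hα, hle⟩ := h.lower δ hδ
    have hBΩ' := hBΩ.trans sdiff_subset
    exact volume_eq_zero_of_testOp_nonpos hn hΩo hΩb hBΩ' hB.nullMeasurableSet hα
      fun f => (hle B hB hBΩ' hBσ f).trans (hd f)
  simpa using this

/-- The hull of the support of `σ - 1` is the hull of the density points of all sets whose test
operator is dominated by a controlled form. -/
theorem IsControlled.essConvexHull_eq (hn : 2 ≤ n) (hΩo : IsOpen Ω)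
    (hΩb : Bornology.IsBounded Ω) (hσ : LinftyPlus Ω σ) {d : X Ω p → ℝ}
    (h : IsControlled Ω p σ d) {S : Set (Set (E n))}
    (hS : ∀ B, B ∈ S ↔ B ⊆ Ω ∧ NullMeasurableSet B volume ∧
      ∃ α : ℝ, 0 < α ∧ ∀ f, α * testOp Ω p B f f ≤ d f) :
    essConvexHull (essSupp Ω fun x => σ x - 1) = essConvexHull (⋃ B ∈ S, measureInterior B) := by
  refine essConvexHull_congr fun ρ t => ?_
  rw [volume_essSupp_diff_halfSpace_eq_zero_iff hΩo]
  simp only [sub_eq_zero]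
  constructor
  · intro hone
    have hdiff : ∀ {ρ : E n} {t : ℝ}, ρ ≠ 0 →
        (∀ᵐ x ∂(volume.restrict Ω), x ∉ halfSpace ρ t → σ x = 1) →
        ∀ B ∈ S, measureInterior B ⊆ halfSpace ρ t := by
      intro ρ t hρ hone B hBS
      obtain ⟨hBΩ, hBm, α, hα, hle⟩ := (hS B).1 hBS
      obtain ⟨M, hM, hup⟩ := h.upper
      have hcl := isClosed_halfSpace ρ t
      exact measureInterior_subset_of_isClosed hcl (volume_diff_halfSpace_eq_zero hn hΩo hΩb hBΩ
        hBm hρ hα hM fun f => (hle f).trans (hup _ hcl.measurableSet hone f))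
    have hempty : (⋃ B ∈ S, measureInterior B) \ halfSpace ρ t = ∅ := by
      refine sdiff_eq_empty.2 (iUnion₂_subset fun B hBS x hx => ?_)
      -- For `ρ = 0` a half-space not containing `x` is empty, so `σ = 1` a.e. on `Ω`. Then every
      -- half-space is admissible, in particular one with nonzero normal that excludes `x`.
      by_cases hρ : ρ = 0
      · by_contra hxH
        have hall : ∀ y : E n, y ∉ halfSpace ρ t := fun y hy => hxH (by
          simpa [halfSpace, hρ] using hy)
        let e : E n := EuclideanSpace.single ⟨0, by omega⟩ 1
        have he : e ≠ 0 := by simp [e]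
        have hxe := hdiff (t := inner ℝ x e - 1) he
          (hone.mono fun y hy _ => hy (hall y)) B hBS hx
        have : inner ℝ x e ≤ inner ℝ x e - 1 := hxe
        linarith
      · exact hdiff hρ hone B hBS hx
    rw [hempty, measure_empty]
  · intro hU
    refine ae_eq_one_of_forall_level hΩo hσ.1.1 (isClosed_halfSpace ρ t).measurableSet
      fun δ hδ B hB hBΩ hBσ => ?_
    obtain ⟨α, hα, hle⟩ := h.lower δ hδ
    have hBΩ' := hBΩ.trans sdiff_subset
    have hBS : B ∈ S := (hS B).2 ⟨hBΩ', hB.nullMeasurableSet, α, hα, hle B hB hBΩ' hBσ⟩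
    -- The level set `B` is marked, so its density points outside the half-space lie in a null set
    -- by hypothesis; its other points are null by Lebesgue density.
    refine measure_mono_null (t := (B \ measureInterior B) ∪
      ((⋃ B ∈ S, measureInterior B) \ halfSpace ρ t)) (fun x hx => ?_)
      (measure_union_null (volume_diff_measureInterior hB) hU)
    by_cases hxi : x ∈ measureInterior B
    · exact Or.inr ⟨mem_iUnion₂.2 ⟨B, hBS, hxi⟩, (hBΩ hx).2⟩
    · exact Or.inl ⟨hx, hxi⟩

theorem testOp_self_nonneg (B : Set (E n)) (f : X Ω p) : 0 ≤ testOp Ω p B f f := by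
  rw [testOp_self]
  exact integral_nonneg fun x => by positivity

/-- Recovery of the hull of the inclusion and of the sign of `σ - 1`. -/
theorem dnMap_recovery (hn : 2 ≤ n) (hΩo : IsOpen Ω) (hΩb : Bornology.IsBounded Ω)
    (hσ : LinftyPlus Ω σ)
    (hsign : (∀ᵐ x ∂(volume.restrict Ω), 1 ≤ σ x) ∨ (∀ᵐ x ∂(volume.restrict Ω), σ x ≤ 1)) :
    essConvexHull (essSupp Ω (fun x => σ x - 1)) =
      essConvexHull (⋃ B ∈ markedSets Ω p (dnMap Ω p σ), measureInterior B) ∧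
    ((∀ᵐ x ∂(volume.restrict Ω), 1 ≤ σ x) ↔
      OpLE (fun f g => dnMap Ω p (fun _ => 1) f g) (fun f g => dnMap Ω p σ f g)) ∧
    ((∀ᵐ x ∂(volume.restrict Ω), σ x ≤ 1) ↔
      OpLE (fun f g => dnMap Ω p σ f g) (fun f g => dnMap Ω p (fun _ => 1) f g)) := by
  have hn0 : 0 < n := by omega
  rcases hsign with h1 | h1
  · have hc := isControlled_of_one_le (p := p) hσ hn0 hΩb h1
    refine ⟨hc.essConvexHull_eq hn hΩo hΩb hσ fun B => ?_, ?_, ?_⟩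
    · refine and_congr_right fun _ => and_congr_right fun _ => exists_congr fun α =>
        and_congr_right fun hα => ⟨?_, fun h => Or.inl fun f => ?_⟩
      · rintro (h | h) f
        -- The alternative matching the sign of `σ - 1` is the required inequality. The other one
        -- forces `α Λ_B ≤ 0 ≤ d`, which implies the inequality as well.
        · linarith [h f]
        · linarith [h f, hc.nonneg f, mul_nonneg hα.le (testOp_self_nonneg B f)]
      · linarith [h f]
    · exact ⟨fun _ f => sub_nonneg.1 (hc.nonneg f), fun _ => h1⟩
    · refine ⟨fun h2 f => ?_, fun h => ?_⟩
      · exact sub_nonneg.1 ((isControlled_of_le_one (p := p) hσ hn0 hΩb h2).nonneg f)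
      -- Here both signs hold for the controlled form, so `σ = 1` a.e.
      · exact (hc.ae_eq_one hn hΩo hΩb hσ fun f => sub_nonpos.2 (h f)).mono fun x hx => hx.le
  · have hc := isControlled_of_le_one (p := p) hσ hn0 hΩb h1
    refine ⟨hc.essConvexHull_eq hn hΩo hΩb hσ fun B => ?_, ?_, ?_⟩
    · refine and_congr_right fun _ => and_congr_right fun _ => exists_congr fun α =>
        and_congr_right fun hα => ⟨?_, fun h => Or.inr fun f => ?_⟩
      · rintro (h | h) f
        · linarith [h f, hc.nonneg f, mul_nonneg hα.le (testOp_self_nonneg B f)]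
        · linarith [h f]
      · linarith [h f]
    · refine ⟨fun h2 f => ?_, fun h => ?_⟩
      · exact sub_nonneg.1 ((isControlled_of_one_le (p := p) hσ hn0 hΩb h2).nonneg f)
      · exact (hc.ae_eq_one hn hΩo hΩb hσ fun f => sub_nonpos.2 (h f)).mono fun x hx => hx.ge
    · exact ⟨fun _ f => sub_nonneg.1 (hc.nonneg f), fun _ => h1⟩

end Tests

end PCalderon

end

/-! ### Well-posedness, determination and recovery -/

theorem theorem1p1 (n : ℕ) (hn : 2 ≤ n) (p : ℝ) [Fact (1 < p)] (Ω : Set (PCalderon.E n))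
    (hΩo : IsOpen Ω) (hΩb : Bornology.IsBounded Ω) :
    -- the forward problem is well posed and the Dirichlet–Neumann map is well defined
    (∀ σ : PCalderon.E n → ℝ, PCalderon.LinftyPlus Ω σ → ∀ f : PCalderon.X Ω p,
      (∃! u : PCalderon.W Ω p, PCalderon.IsMinimizer σ f u) ∧
      ∀ u v : PCalderon.W Ω p, PCalderon.IsMinimizer σ f u →
        PCalderon.dnMap Ω p σ f (PCalderon.trace v) = PCalderon.fluxForm Ω σ u v) ∧
    -- it determines the essential convex hull of the inclusion and the sign of `σ - 1`
    (∀ σ₁ σ₂ : PCalderon.E n → ℝ,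
      PCalderon.LinftyPlus Ω σ₁ → PCalderon.LinftyPlus Ω σ₂ →
      ((∀ᵐ x ∂(volume.restrict Ω), 1 ≤ σ₁ x) ∨ (∀ᵐ x ∂(volume.restrict Ω), σ₁ x ≤ 1)) →
      ((∀ᵐ x ∂(volume.restrict Ω), 1 ≤ σ₂ x) ∨ (∀ᵐ x ∂(volume.restrict Ω), σ₂ x ≤ 1)) →
      PCalderon.dnMap Ω p σ₁ = PCalderon.dnMap Ω p σ₂ →
      PCalderon.essConvexHull (PCalderon.essSupp Ω (fun x => σ₁ x - 1)) =
        PCalderon.essConvexHull (PCalderon.essSupp Ω (fun x => σ₂ x - 1)) ∧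
      ((∀ᵐ x ∂(volume.restrict Ω), 1 ≤ σ₁ x) ↔ (∀ᵐ x ∂(volume.restrict Ω), 1 ≤ σ₂ x)) ∧
      ((∀ᵐ x ∂(volume.restrict Ω), σ₁ x ≤ 1) ↔ (∀ᵐ x ∂(volume.restrict Ω), σ₂ x ≤ 1))) ∧
    -- both are recovered explicitly from the Dirichlet–Neumann map
    (∀ σ : PCalderon.E n → ℝ, PCalderon.LinftyPlus Ω σ →
      ((∀ᵐ x ∂(volume.restrict Ω), 1 ≤ σ x) ∨ (∀ᵐ x ∂(volume.restrict Ω), σ x ≤ 1)) →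
      PCalderon.essConvexHull (PCalderon.essSupp Ω (fun x => σ x - 1)) =
        PCalderon.essConvexHull (⋃ B ∈ PCalderon.markedSets Ω p (PCalderon.dnMap Ω p σ),
          PCalderon.measureInterior B) ∧
      ((∀ᵐ x ∂(volume.restrict Ω), 1 ≤ σ x) ↔
        PCalderon.OpLE (fun f g => PCalderon.dnMap Ω p (fun _ => 1) f g)
          (fun f g => PCalderon.dnMap Ω p σ f g)) ∧
      ((∀ᵐ x ∂(volume.restrict Ω), σ x ≤ 1) ↔
        PCalderon.OpLE (fun f g => PCalderon.dnMap Ω p σ f g)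
          (fun f g => PCalderon.dnMap Ω p (fun _ => 1) f g))) := by
  have hn0 : 0 < n := by omega
  refine ⟨fun σ hσ f => ⟨hσ.existsUnique_isMinimizer hn0 hΩb f, fun u v hu => ?_⟩,
    fun σ₁ σ₂ h₁ h₂ hs₁ hs₂ hΛ => ?_, fun σ hσ hs => PCalderon.dnMap_recovery hn hΩo hΩb hσ hs⟩
  · rw [PCalderon.dnMap_trace hσ hn0 hΩb, hσ.solution_eq hn0 hΩb hu]
  · obtain ⟨a₁, b₁, c₁⟩ := PCalderon.dnMap_recovery (p := p) hn hΩo hΩb h₁ hs₁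
    obtain ⟨a₂, b₂, c₂⟩ := PCalderon.dnMap_recovery (p := p) hn hΩo hΩb h₂ hs₂
    -- The recovery formulas involve the conductivity only through its Dirichlet–Neumann map.
    rw [a₁, a₂, b₁, b₂, c₁, c₂, hΛ]
    exact ⟨rfl, Iff.rfl, Iff.rfl⟩
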